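/- Let $n\ge 0$, let $[Z_0:\dots:Z_n]$ be homogeneous coordinates on $\mathbb P^n$, and let $H$ be the hyperplane bundle, with the flag $Y_i=V(Z_0,\dots,Z_{i-1})$, $0\le i\le n$, the chart $z_i=Z_i/Z_n$ ($0\le i\le n-1$) on $\{Z_n\neq 0\}$, and the standard trivialization of $H$ there (the section $Z_i$ becomes $z_i$, and $Z_n$ becomes $1$). For a section $s\ne0$ of $mH$ with Taylor expansion $\sum_\alpha k_\alpha z^\alpha$ at $z=0$, let $\nu(s)\in\mathbb N^n$ be the lexicographically smallest $\alpha$ with $k_\alpha\neq0$. Let $\Delta_m(H)=\{\nu(s): 0\ne s\in H^0(\mathbb P^n,mH)\}$, and let $\Delta(H)=\overline{\bigcup_{m\ge1}\frac1m\Delta_m(H)}\subset\mathbb R^n$ be the Okounkov body. For a continuous potential $\varphi$ on $H$, a smooth positive volume form $\mu$ on $\mathbb P^n$ and $\alpha\in\frac1m\Delta_m(H)$, a Chebyshev section $Ch_{m,\alpha}$ is a minimizer of $$\|s\|_{\varphi,\mu}^2=\int_{\mathbb P^n}|s|^2e^{-m\varphi}\,d\mu$$ among the sections $s$ of $mH$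 with leading term $k_{\nu(s)}z^{\nu(s)}=z^{m\alpha}$. The Chebyshev potential of $\varphi$ at $\alpha$ is $$c[\varphi](\alpha)=\lim_{k\to\infty}\frac1{m_k}\log\|Ch_{m_k,\alpha_k}\|_{\varphi,\mu}^2,$$ where $m_k$ is a strictly increasing sequence of natural numbers and $\alpha_k\in\frac1{m_k}\Delta_{m_k}(H)$ converges to $\alpha$; it is well defined if such sequences exist, the Chebyshev sections exist and are unique, and the limit exists and does not depend on $(m_k)$, $(\alpha_k)$ and $\mu$. Let $P=(p_{jk})_{0\le j,k\le n}$ be a positive definite Hermitian matrix, let $\varphi_P=\log(z^*Pz)$ with $z=(z_0,\dots,z_{n-1},1)^{\mathsf T}$ be the associated Fubini–Study potential, and put $\mu_i(P)=\det_i(P)/\det_{i+1}(P)$ for $0\le i\le n$, where $\det_i(P)=\det(p_{jk})_{i\le j,k\le n}$ and $\det_{n+1}(P)=1$. **Theorem.** The Okounkov body is the simplex $\Delta(H)=\{\alpha\in\mathbb R_{\ge0}^n:\sum_i\alpha_i\le1\}$, and for every $\alpha=(\alpha_0,\dots,\alpha_{n-1})\in\Delta(H)$ the Chebyshev potential of $\varphi_P$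 is well defined and equals $$c[\varphi_P](\alpha)=\sum_{i=0}^{n-1}\alpha_i\log\frac{\alpha_i}{\mu_i(P)}+\Bigl(1-\sum_{i=0}^{n-1}\alpha_i\Bigr)\log\frac{1-\sum_{i=0}^{n-1}\alpha_i}{\mu_n(P)},$$ with the convention $0\log 0=0$ on the boundary of the simplex. -/

import Mathlib

open Filter Topology MeasureTheory Matrix
open scoped ComplexOrder ContDiff LinearAlgebra.Projectivization

noncomputable section

namespace Chebyshev

/-- Homogeneous coordinates `(z₀, …, zₙ₋₁, 1)` of the point of `{Zₙ ≠ 0}` whose coordinates in the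
standard chart `zᵢ = Zᵢ / Zₙ` are `z`. -/
def lift {n : ℕ} (z : Fin n → ℂ) : Fin (n + 1) → ℂ :=
  Fin.snoc (α := fun _ => ℂ) z 1

theorem lift_ne_zero {n : ℕ} (z : Fin n → ℂ) : lift z ≠ 0 := by
  intro h
  have := congrFun h (Fin.last n)
  simp [lift] at this

/-- The standard chart of `{Zₙ ≠ 0} ⊆ ℙⁿ`, as a parametrization. -/
def chart {n : ℕ} (z : Fin n → ℂ) : ℙ ℂ (Fin (n + 1) → ℂ) :=
  Projectivization.mk ℂ (lift z) (lift_ne_zero z)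

/-- The standard flag `Yᵢ = V(Z₀, …, Zᵢ₋₁)` of `ℙⁿ`. -/
def flag (n i : ℕ) : Set (ℙ ℂ (Fin (n + 1) → ℂ)) :=
  {p | ∀ j : Fin (n + 1), (j : ℕ) < i → p.rep j = 0}

/-- The standard chart is adapted to the standard flag: in it, `Yᵢ` is `{z₀ = ⋯ = zᵢ₋₁ = 0}`. -/
theorem chart_mem_flag_iff {n i : ℕ} (hi : i ≤ n) (z : Fin n → ℂ) :
    chart z ∈ flag n i ↔ ∀ j : Fin n, (j : ℕ) < i → z j = 0 := by
  obtain ⟨a, ha⟩ := Projectivization.exists_smul_eq_mk_rep ℂ (lift z) (lift_ne_zero z)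
  have key : ∀ j : Fin (n + 1), (chart z).rep j = 0 ↔ lift z j = 0 := by
    intro j
    have h1 : (chart z).rep j = (a : ℂ) * lift z j := by
      rw [chart, ← ha]; rfl
    rw [h1]; simp
  simp only [flag, Set.mem_ofPred_eq, key]
  constructor
  · intro h j hj
    simpa [lift] using h j.castSucc (by simpa using hj)
  · intro h j
    refine Fin.lastCases ?_ (fun k => ?_) j
    · intro hj
      simp at hj
      omega
    · intro hk
      simpa [lift] using h k (by simpa using hk)

/-- The space `H⁰(ℙⁿ, mH)` of global holomorphic sections of the `m`-th power of the hyperplane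
bundle: holomorphic functions on `ℂⁿ⁺¹ ∖ {0}` that are homogeneous of degree `m`. (The value at the
origin carries no information and is set to `0`.) -/
def sections (n m : ℕ) : Submodule ℂ ((Fin (n + 1) → ℂ) → ℂ) where
  carrier := {F | DifferentiableOn ℂ F {0}ᶜ ∧
    (∀ (c : ℂ) (Z : Fin (n + 1) → ℂ), c ≠ 0 → Z ≠ 0 → F (c • Z) = c ^ m * F Z) ∧ F 0 = 0}
  zero_mem' := ⟨differentiableOn_const (𝕜 := ℂ) (0 : ℂ), by simp, rfl⟩
  add_mem' := by
    rintro F G ⟨hF, hF', hF0⟩ ⟨hG, hG', hG0⟩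
    refine ⟨hF.add hG, fun c Z hc hZ => ?_, by simp [hF0, hG0]⟩
    simp only [Pi.add_apply, hF' c Z hc hZ, hG' c Z hc hZ]
    ring
  smul_mem' := by
    rintro a F ⟨hF, hF', hF0⟩
    refine ⟨hF.const_smul a, fun c Z hc hZ => ?_, by simp [hF0]⟩
    simp only [Pi.smul_apply, smul_eq_mul, hF' c Z hc hZ]
    ring

/-- The expression of a section of `mH` in the standard chart and the standard trivialization of
`H` over `{Zₙ ≠ 0}` (in which the section `Zᵢ` of `H` becomes `zᵢ`, and `Zₙ` becomes `1`). -/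
def localExpr {n m : ℕ} (s : sections n m) (z : Fin n → ℂ) : ℂ :=
  (s : (Fin (n + 1) → ℂ) → ℂ) (lift z)

/-- The complex partial derivative `∂f/∂zᵢ`. -/
def partialDeriv {n : ℕ} (i : Fin n) (f : (Fin n → ℂ) → ℂ) : (Fin n → ℂ) → ℂ :=
  fun z => fderiv ℂ f z (Pi.single i 1)

/-- The iterated partial derivative `∂^α f`. -/
def iterPartialDeriv {n : ℕ} (α : Fin n → ℕ) (f : (Fin n → ℂ) → ℂ) : (Fin n → ℂ) → ℂ :=
  (List.finRange n).foldr (fun i g => (partialDeriv i)^[α i] g) f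

/-- The coefficient of `z^α` in the Taylor expansion of `f` at the origin. -/
def taylorCoeff {n : ℕ} (f : (Fin n → ℂ) → ℂ) (α : Fin n → ℕ) : ℂ :=
  iterPartialDeriv α f 0 / ∏ i, ((α i).factorial : ℂ)

/-- `ν(s) = β`: the exponent `β` is the lexicographically smallest one whose Taylor coefficient
does not vanish. -/
def HasValuation {n m : ℕ} (s : sections n m) (β : Fin n → ℕ) : Prop :=
  taylorCoeff (localExpr s) β ≠ 0 ∧
    ∀ α : Fin n → ℕ, toLex α < toLex β → taylorCoeff (localExpr s) α = 0

/-- `Δₘ(H)`: the set of valuations of nonzero sections of `mH`. -/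
def valuations (n m : ℕ) : Set (Fin n → ℕ) :=
  {β | ∃ s : sections n m, s ≠ 0 ∧ HasValuation s β}

/-- The Okounkov body of `H`: the closure of the union of all `(1/m) Δₘ(H)`, `m ≥ 1`. -/
def okounkovBody (n : ℕ) : Set (Fin n → ℝ) :=
  closure (⋃ (m : ℕ) (_ : 1 ≤ m), (fun (β : Fin n → ℕ) (i : Fin n) => (β i : ℝ) / (m : ℝ)) '' valuations n m)

/-- The sections of `mH` whose leading term is exactly `z^β`. -/
def monicSections (n m : ℕ) (β : Fin n → ℕ) : Set (sections n m) :=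
  {s | HasValuation s β ∧ taylorCoeff (localExpr s) β = 1}

/-- A continuous potential on `H`, i.e. a continuous Hermitian metric
`|Zᵢ|² e^{-φ(Z)}` on `H`, written through a function `φ` of the homogeneous coordinates. -/
structure Potential (n : ℕ) where
  /-- the potential, as a function on `ℂⁿ⁺¹ ∖ {0}` -/
  toFun : (Fin (n + 1) → ℂ) → ℝ
  continuousOn_toFun : ContinuousOn toFun {0}ᶜ
  map_smul : ∀ (c : ℂ) (Z : Fin (n + 1) → ℂ), c ≠ 0 → Z ≠ 0 →
    toFun (c • Z) = toFun Z + 2 * Real.log ‖c‖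

/-- The potential in the standard chart and trivialization over `{Zₙ ≠ 0}`. -/
def Potential.weight {n : ℕ} (φ : Potential n) (z : Fin n → ℂ) : ℝ :=
  φ.toFun (lift z)

/-- A (positive) smooth volume form on `ℙⁿ`. In the affine chart `{Zᵢ ≠ 0}` it is `density`,
restricted to `Zᵢ = 1`, times Lebesgue measure. The homogeneity is exactly the transformation law
between these charts, whose real Jacobians are `|Zⱼ / Zᵢ|^{2(n+1)}`. -/
structure VolumeForm (n : ℕ) where
  /-- the density, as a function on `ℂⁿ⁺¹ ∖ {0}` -/
  density : (Fin (n + 1) → ℂ) → ℝ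
  contDiffOn_density : ContDiffOn ℝ ∞ density {0}ᶜ
  density_pos : ∀ Z : Fin (n + 1) → ℂ, Z ≠ 0 → 0 < density Z
  density_smul : ∀ (c : ℂ) (Z : Fin (n + 1) → ℂ), c ≠ 0 → Z ≠ 0 →
    density (c • Z) = (‖c‖ ^ (2 * (n + 1)))⁻¹ * density Z

/-- The Hermitian inner product `∫ s \bar t e^{-mφ} dμ` on `H⁰(ℙⁿ, mH)`. The integral is taken in
the chart `{Zₙ ≠ 0}`, whose complement is a null set. -/
def hilb {n m : ℕ} (φ : Potential n) (μ : VolumeForm n) (s t : sections n m) : ℂ :=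
  ∫ z : Fin n → ℂ, localExpr s z * (starRingEnd ℂ) (localExpr t z) *
    ((Real.exp (-(m : ℝ) * φ.weight z) * μ.density (lift z) : ℝ) : ℂ)

/-- The squared norm of a section. -/
def normSq {n m : ℕ} (φ : Potential n) (μ : VolumeForm n) (s : sections n m) : ℝ :=
  (hilb φ μ s s).re

/-- `s` minimizes the norm among the sections of `mH` with leading term `z^β`. -/
def IsChebyshevSection {n m : ℕ} (φ : Potential n) (μ : VolumeForm n) (β : Fin n → ℕ)
    (s : sections n m) : Prop :=
  s ∈ monicSections n m β ∧ ∀ t ∈ monicSections n m β, normSq φ μ s ≤ normSq φ μ t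

/-- `m` is strictly increasing, `β k / m k ∈ (1 / m k) Δ_{m k}(H)`, and these points converge
to `α`. -/
structure Approximates {n : ℕ} (α : Fin n → ℝ) (m : ℕ → ℕ) (β : ℕ → Fin n → ℕ) : Prop where
  strictMono : StrictMono m
  mem_valuations : ∀ k, β k ∈ valuations n (m k)
  tendsto : Tendsto (fun k (i : Fin n) => (β k i : ℝ) / (m k : ℝ)) atTop (𝓝 α)

/-- The Chebyshev potential of `φ` is well defined at `α` and equals `c`: the point `α` can be
approximated, and for every smooth volume form and every approximating sequence, the Chebyshev
sections exist, are unique, and `(1 / mₖ) log ‖Ch‖²` converges to `c`. -/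
def HasChebyshevPotential {n : ℕ} (φ : Potential n) (α : Fin n → ℝ) (c : ℝ) : Prop :=
  (∃ m β, Approximates α m β) ∧
    ∀ (μ : VolumeForm n) (m : ℕ → ℕ) (β : ℕ → Fin n → ℕ), Approximates α m β →
      ∃ Ch : ∀ k, sections n (m k),
        (∀ k, IsChebyshevSection φ μ (β k) (Ch k) ∧
          ∀ s : sections n (m k), IsChebyshevSection φ μ (β k) s → s = Ch k) ∧
        Tendsto (fun k => 1 / (m k : ℝ) * Real.log (normSq φ μ (Ch k))) atTop (𝓝 c)

/-- The Hermitian form `Z* P Z`. -/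
def hermForm {n : ℕ} (P : Matrix (Fin (n + 1)) (Fin (n + 1)) ℂ) (Z : Fin (n + 1) → ℂ) : ℝ :=
  (star Z ⬝ᵥ (P *ᵥ Z)).re

theorem hermForm_pos {n : ℕ} {P : Matrix (Fin (n + 1)) (Fin (n + 1)) ℂ} (hP : P.PosDef)
    {Z : Fin (n + 1) → ℂ} (hZ : Z ≠ 0) : 0 < hermForm P Z :=
  (Complex.pos_iff.1 (hP.dotProduct_mulVec_pos hZ)).1

theorem contDiff_hermForm {n : ℕ} (P : Matrix (Fin (n + 1)) (Fin (n + 1)) ℂ) :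
    ContDiff ℝ ∞ (hermForm P) := by
  unfold hermForm
  simp only [dotProduct, mulVec, Pi.star_apply, Complex.re_sum]
  refine ContDiff.sum fun i _ => ?_
  refine Complex.reCLM.contDiff.comp (ContDiff.mul ?_ (ContDiff.sum fun j _ => ?_))
  · exact Complex.conjCLE.contDiff.comp (contDiff_apply ℝ ℂ i)
  · exact contDiff_const.mul (contDiff_apply ℝ ℂ j)

theorem hermForm_smul {n : ℕ} (P : Matrix (Fin (n + 1)) (Fin (n + 1)) ℂ) (c : ℂ)
    (Z : Fin (n + 1) → ℂ) : hermForm P (c • Z) = ‖c‖ ^ 2 * hermForm P Z := by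
  unfold hermForm
  rw [star_smul, mulVec_smul, smul_dotProduct, dotProduct_smul, smul_eq_mul, smul_eq_mul,
    ← mul_assoc]
  have : star c * c = ((‖c‖ ^ 2 : ℝ) : ℂ) := by
    push_cast
    exact Complex.conj_mul' c
  rw [this, Complex.re_ofReal_mul]

/-- The Fubini–Study potential `φ_P = log (z* P z)`. -/
def fubiniStudy {n : ℕ} (P : Matrix (Fin (n + 1)) (Fin (n + 1)) ℂ) (hP : P.PosDef) :
    Potential n where
  toFun Z := Real.log (hermForm P Z)
  continuousOn_toFun := (contDiff_hermForm P).continuous.continuousOn.log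
    fun _ hZ => (hermForm_pos hP hZ).ne'
  map_smul c Z hc hZ := by
    have h1 : ‖c‖ ^ 2 ≠ 0 := pow_ne_zero _ (norm_ne_zero_iff.2 hc)
    rw [hermForm_smul, Real.log_mul h1 (hermForm_pos hP hZ).ne', Real.log_pow]
    push_cast
    ring

/-- The Fubini–Study volume form (up to a constant factor). -/
instance (n : ℕ) : Inhabited (VolumeForm n) where
  default :=
    { density := fun Z => (hermForm 1 Z ^ (n + 1))⁻¹
      contDiffOn_density := by
        refine ContDiffOn.inv ((contDiff_hermForm 1).pow (n + 1)).contDiffOn fun Z hZ => ?_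
        exact pow_ne_zero _ (hermForm_pos PosDef.one hZ).ne'
      density_pos := fun Z hZ => inv_pos.2 (pow_pos (hermForm_pos PosDef.one hZ) _)
      density_smul := fun c Z _ _ => by
        rw [hermForm_smul, mul_pow, mul_inv, ← pow_mul] }

/-- The trailing principal minor `det_i(P)` on the rows and columns `i, …, n`
(equal to `1` for `i > n`). -/
def trailingMinor {n : ℕ} (P : Matrix (Fin (n + 1)) (Fin (n + 1)) ℂ) (i : ℕ) : ℝ :=
  (P.submatrix (Subtype.val : {j : Fin (n + 1) // i ≤ (j : ℕ)} → Fin (n + 1))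
    (Subtype.val : {j : Fin (n + 1) // i ≤ (j : ℕ)} → Fin (n + 1))).det.re

/-- `μᵢ(P) = det_i(P) / det_{i+1}(P)`. -/
def minorRatio {n : ℕ} (P : Matrix (Fin (n + 1)) (Fin (n + 1)) ℂ) (i : ℕ) : ℝ :=
  trailingMinor P i / trailingMinor P (i + 1)

end Chebyshev

end

/-!
The norms of sections with respect to the potential `φ_P` and a volume form can be compared, up to
factors independent of `m`, for any two smooth volume forms (`exists_density_le`), and such factors
disappear in `(1 / m) log`. For the volume form `(Z* P Z) ^ (-(n + 1))` the norm can be computed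
exactly: integrating first along the fibres of `ℂⁿ⁺¹ ∖ {0} → ℙⁿ`, one finds that
`π (m + n)! ‖s‖²` is the Gaussian integral `∫ |s(Z)|² exp (-Z* P Z)` over `ℂⁿ⁺¹`
(`normSq_fubiniStudy_eq_integral`).

The matrix factors as `P = Aᴴ D A` with `A` unit lower triangular and `D` diagonal with entries
`μᵢ(P)` (`exists_unitLower_diagonal`, `minorRatio_eq`). In the coordinates `w = A Z` the Gaussian
weight is a product over the coordinates, so the monomials `w ^ b` with `|b| = m` are orthogonal,
with squared norms `∏ π bᵢ! / μᵢ ^ (bᵢ + 1)` (`normSq_fubiniStudy_sum`). They span the sections of `mH`,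
because an entire function of polynomial growth is a polynomial (`span_frameSection_eq_top`), and
since `A` is triangular, `w ^ b` has the same leading term as `Z ^ b` (`IsUnitLower.hasLexLead`).
Hence the valuations are the exponents of degree at most `m`, the Okounkov body is the simplex, and
the Chebyshev section for this volume form is `w ^ b` itself. Stirling's formula turns its norm into
the asserted entropy (`exists_log_norm_bound`), whose continuity on the closed simplex makes the
limit independent of the approximating sequence.

For an arbitrary volume form, Chebyshev sections exist and are unique because sections form a
finite-dimensional space with a positive definite Hermitian form, and monic sections form an affine
subspace of it (`exists_unique_isChebyshevSection`).
-/

noncomputable section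

namespace Chebyshev

/-! ### Taylor coefficients of polynomials -/

theorem differentiable_eval {n : ℕ} (p : MvPolynomial (Fin n) ℂ) :
    Differentiable ℂ fun z : Fin n → ℂ => MvPolynomial.eval z p := by
  induction p using MvPolynomial.induction_on with
  | C a => simp
  | add p q hp hq => simpa using! hp.add hq
  | mul_X p i hp => simpa using! hp.mul (differentiable_apply i)

theorem partialDeriv_eval {n : ℕ} (i : Fin n) (p : MvPolynomial (Fin n) ℂ) :
    partialDeriv i (fun z => MvPolynomial.eval z p) =
      fun z => MvPolynomial.eval z (MvPolynomial.pderiv i p) := by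
  funext z
  induction p using MvPolynomial.induction_on with
  | C a => simp [partialDeriv]
  | add p q hp hq =>
    have := fderiv_add (differentiable_eval p z) (differentiable_eval q z)
    simp only [partialDeriv, map_add] at hp hq ⊢
    rw [← hp, ← hq]
    exact DFunLike.congr_fun this _
  | mul_X p j hp =>
    have hX : HasFDerivAt (fun z : Fin n → ℂ => z j)
        (ContinuousLinearMap.proj (R := ℂ) (φ := fun _ : Fin n => ℂ) j) z := hasFDerivAt_apply j z
    have := ((differentiable_eval p z).hasFDerivAt.mul hX).fderiv
    have h2 := DFunLike.congr_fun this (Pi.single i 1)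
    simp only [partialDeriv] at hp ⊢
    simp only [map_mul, MvPolynomial.eval_X, Derivation.leibniz, smul_eq_mul, map_add,
      MvPolynomial.pderiv_X, ← hp]
    refine h2.trans ?_
    rcases eq_or_ne j i with rfl | h
    · simp
    · simp [h]

theorem iterPartialDeriv_eval {n : ℕ} (α : Fin n → ℕ) (p : MvPolynomial (Fin n) ℂ) :
    iterPartialDeriv α (fun z => MvPolynomial.eval z p) = fun z => MvPolynomial.eval z
      ((List.finRange n).foldr (fun i q => (MvPolynomial.pderiv i)^[α i] q) p) := by
  have hit : ∀ (i : Fin n) (k : ℕ) (q : MvPolynomial (Fin n) ℂ),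
      (partialDeriv i)^[k] (fun z => MvPolynomial.eval z q) =
        fun z => MvPolynomial.eval z ((MvPolynomial.pderiv i)^[k] q) := by
    intro i k
    induction k with
    | zero => simp
    | succ k ih =>
      intro q
      rw [Function.iterate_succ_apply, Function.iterate_succ_apply, partialDeriv_eval, ih]
  unfold iterPartialDeriv
  induction List.finRange n with
  | nil => simp
  | cons i l ih => simp only [List.foldr_cons, ih, hit]

/-- Repeated differentiation in a direction in which the target exponent `d` vanishes produces
exactly a factorial. -/
theorem coeff_iterate_pderiv {n : ℕ} (i : Fin n) (k : ℕ) (p : MvPolynomial (Fin n) ℂ)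
    (d : Fin n →₀ ℕ) (hd : d i = 0) :
    MvPolynomial.coeff d ((MvPolynomial.pderiv i)^[k] p) =
      MvPolynomial.coeff (d + Finsupp.single i k) p * (k.factorial : ℂ) := by
  induction k generalizing p with
  | zero => simp
  | succ k ih =>
    rw [Function.iterate_succ_apply, ih, MvPolynomial.coeff_pderiv, add_assoc,
      ← Finsupp.single_add, Nat.factorial_succ]
    simp [hd]
    ring

theorem coeff_foldr_pderiv {n : ℕ} (α : Fin n → ℕ) (p : MvPolynomial (Fin n) ℂ)
    (l : List (Fin n)) (hl : l.Nodup) (d : Fin n →₀ ℕ) (hd : ∀ i ∈ l, d i = 0) :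
    MvPolynomial.coeff d (l.foldr (fun i q => (MvPolynomial.pderiv i)^[α i] q) p) =
      MvPolynomial.coeff (d + (l.map fun i => Finsupp.single i (α i)).sum) p *
        (l.map fun i => ((α i).factorial : ℂ)).prod := by
  induction l generalizing d with
  | nil => simp
  | cons i l ih =>
    rw [List.nodup_cons] at hl
    rw [List.foldr_cons, coeff_iterate_pderiv _ _ _ _ (hd i (by simp)), ih hl.2]
    · simp only [List.map_cons, List.sum_cons, List.prod_cons, add_assoc]
      ring
    · intro j hj
      have : i ≠ j := fun h => hl.1 (h ▸ hj)
      simp [hd j (by simp [hj]), this]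

/-- For polynomial functions, the Taylor coefficients at the origin are the coefficients. -/
theorem taylorCoeff_eval {n : ℕ} (p : MvPolynomial (Fin n) ℂ) (α : Fin n → ℕ) :
    taylorCoeff (fun z => MvPolynomial.eval z p) α =
      MvPolynomial.coeff (Finsupp.equivFunOnFinite.symm α) p := by
  have hα : ((List.finRange n).map fun i => Finsupp.single i (α i)).sum =
      Finsupp.equivFunOnFinite.symm α := by
    rw [← List.ofFn_eq_map, List.sum_ofFn]
    ext j
    simp [Finsupp.finsetSum_apply, Finsupp.single_apply]
  have hfac : ((List.finRange n).map fun i => ((α i).factorial : ℂ)).prod =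
      ∏ i, ((α i).factorial : ℂ) := by
    rw [← List.ofFn_eq_map, List.prod_ofFn]
  have hne : ∏ i, ((α i).factorial : ℂ) ≠ 0 :=
    Finset.prod_ne_zero_iff.2 fun i _ => by exact_mod_cast (α i).factorial_ne_zero
  rw [taylorCoeff, iterPartialDeriv_eval, div_eq_iff hne, ← hfac, ← hα]
  have := coeff_foldr_pderiv α p _ (List.nodup_finRange n) 0 (by simp)
  rw [zero_add] at this
  rw [← this, ← MvPolynomial.constantCoeff_eq, ← MvPolynomial.eval_zero]

/-- `z ^ b` is the lexicographically smallest monomial of `p`, and its coefficient is `1`. -/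
def HasLexLead {n : ℕ} (p : MvPolynomial (Fin n) ℂ) (b : Fin n →₀ ℕ) : Prop :=
  p.coeff b = 1 ∧ ∀ a : Fin n →₀ ℕ, toLex a < toLex b → p.coeff a = 0

theorem HasLexLead.one {n : ℕ} : HasLexLead (1 : MvPolynomial (Fin n) ℂ) 0 := by
  refine ⟨by simp, fun a ha => ?_⟩
  rw [MvPolynomial.coeff_one, if_neg]
  rintro rfl
  exact lt_irrefl _ ha

theorem HasLexLead.mul {n : ℕ} {p q : MvPolynomial (Fin n) ℂ} {b c : Fin n →₀ ℕ}
    (hp : HasLexLead p b) (hq : HasLexLead q c) : HasLexLead (p * q) (b + c) := by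
  classical
  constructor
  · rw [MvPolynomial.coeff_mul, Finset.sum_eq_single (b, c)]
    · simp [hp.1, hq.1]
    · rintro ⟨x, y⟩ hxy hne
      rw [Finset.HasAntidiagonal.mem_antidiagonal] at hxy
      -- a pair `(x, y) ≠ (b, c)` with `x + y = b + c` has a member below its leading exponent
      rcases lt_trichotomy (toLex x) (toLex b) with h | h | h
      · simp [hp.2 x h]
      · have hxb : x = b := toLex.injective h
        subst hxb
        exact absurd (by simpa using hxy) (fun h' : y = c => hne (by rw [h']))
      · have hy : toLex y < toLex c := by
          by_contra hcy
          have := add_lt_add_of_lt_of_le h (not_lt.1 hcy)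
          rw [← toLex_add, ← toLex_add, hxy] at this
          exact lt_irrefl _ this
        simp [hq.2 y hy]
    · simp
  · intro a ha
    rw [MvPolynomial.coeff_mul]
    refine Finset.sum_eq_zero ?_
    rintro ⟨x, y⟩ hxy
    rw [Finset.HasAntidiagonal.mem_antidiagonal] at hxy
    by_cases h : toLex x < toLex b
    · simp [hp.2 x h]
    · have hy : toLex y < toLex c := by
        by_contra hcy
        have := add_le_add (not_lt.1 h) (not_lt.1 hcy)
        rw [← toLex_add, ← toLex_add, hxy] at this
        exact absurd ha (not_lt.2 this)
      simp [hq.2 y hy]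

theorem HasLexLead.pow {n : ℕ} {p : MvPolynomial (Fin n) ℂ} {b : Fin n →₀ ℕ}
    (hp : HasLexLead p b) (k : ℕ) : HasLexLead (p ^ k) (k • b) := by
  induction k with
  | zero => simpa using HasLexLead.one
  | succ k ih => simpa [pow_succ, add_smul] using ih.mul hp

theorem HasLexLead.prod {n : ℕ} {ι : Type*} (s : Finset ι) {p : ι → MvPolynomial (Fin n) ℂ}
    {b : ι → Fin n →₀ ℕ} (hp : ∀ i ∈ s, HasLexLead (p i) (b i)) :
    HasLexLead (∏ i ∈ s, p i) (∑ i ∈ s, b i) := by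
  classical
  induction s using Finset.induction_on with
  | empty => simpa using HasLexLead.one
  | insert i s hi ih =>
    rw [Finset.prod_insert hi, Finset.sum_insert hi]
    exact (hp i (by simp)).mul (ih fun j hj => hp j (by simp [hj]))

/-- A linear combination of polynomials with distinct lexicographically smallest exponents has the
smallest exponent that occurs in it. -/
theorem coeff_sum_of_hasLexLead {n : ℕ} {ι : Type*} [Fintype ι] (p : ι → MvPolynomial (Fin n) ℂ)
    (b : ι → Fin n →₀ ℕ) (hb : Function.Injective b) (hp : ∀ i, HasLexLead (p i) (b i))
    (c : ι → ℂ) (i : ι) (hc : ∀ j, toLex (b j) < toLex (b i) → c j = 0) :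
    (∑ j, c j • p j).coeff (b i) = c i ∧
      ∀ a : Fin n →₀ ℕ, toLex a < toLex (b i) → (∑ j, c j • p j).coeff a = 0 := by
  constructor
  · rw [MvPolynomial.coeff_sum, Finset.sum_eq_single i]
    · simp [(hp i).1]
    · intro j _ hj
      rcases lt_trichotomy (toLex (b j)) (toLex (b i)) with h | h | h
      · simp [hc j h]
      · exact absurd (hb (toLex.injective h)) hj
      · simp [(hp j).2 _ h]
    · simp
  · intro a ha
    rw [MvPolynomial.coeff_sum]
    refine Finset.sum_eq_zero fun j _ => ?_
    by_cases h : toLex (b j) < toLex (b i)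
    · simp [hc j h]
    · simp [(hp j).2 _ (ha.trans_le (not_lt.1 h))]

/-! ### Global sections are homogeneous polynomials -/

/-- An entire function of one variable of polynomial growth is a polynomial. -/
theorem exists_polynomial_of_growth {g : ℂ → ℂ} (hg : Differentiable ℂ g) {C : ℝ} {m : ℕ}
    (hC : ∀ t, ‖g t‖ ≤ C * (1 + ‖t‖) ^ m) :
    ∃ q : Polynomial ℂ, q.natDegree ≤ m ∧ ∀ t, g t = q.eval t := by
  have hC0 : 0 ≤ C := by simpa using (norm_nonneg _).trans (hC 0)
  -- by Cauchy's estimate on circles of radius `R → ∞`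
  have hder : ∀ k, m < k → iteratedDeriv k g 0 = 0 := by
    intro k hk
    rw [← norm_le_zero_iff]
    have hbound : ∀ᶠ R : ℝ in atTop,
        ‖iteratedDeriv k g 0‖ ≤ (k.factorial * (C * 2 ^ m)) * R⁻¹ := by
      filter_upwards [eventually_ge_atTop 1] with R hR
      have hR0 : 0 < R := by linarith
      have h1 := Complex.norm_iteratedDeriv_le_of_forall_mem_sphere_norm_le (c := 0) (R := R)
        (C := C * (2 * R) ^ m) k hR0 hg.diffContOnCl (fun z hz => by
          have hz' : ‖z‖ = R := by simpa using hz
          refine (hC z).trans ?_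
          rw [hz']
          gcongr
          linarith)
      refine h1.trans ?_
      rw [div_le_iff₀ (by positivity)]
      have h2 : R ^ (m + 1) ≤ R ^ k := pow_le_pow_right₀ hR hk
      calc (k.factorial : ℝ) * (C * (2 * R) ^ m)
          = (k.factorial * (C * 2 ^ m)) * R⁻¹ * R ^ (m + 1) := by
            rw [mul_pow, pow_succ]; field_simp
        _ ≤ _ := by gcongr
    have hlim : Tendsto (fun R : ℝ => (k.factorial * (C * 2 ^ m)) * R⁻¹) atTop (𝓝 0) := by
      simpa using tendsto_inv_atTop_zero.const_mul (k.factorial * (C * 2 ^ m))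
    exact ge_of_tendsto hlim hbound
  refine ⟨∑ k ∈ Finset.range (m + 1),
    Polynomial.C ((k.factorial : ℂ)⁻¹ * iteratedDeriv k g 0) * Polynomial.X ^ k, ?_, fun t => ?_⟩
  · refine Polynomial.natDegree_sum_le_of_forall_le _ _ fun k hk => ?_
    exact (Polynomial.natDegree_C_mul_X_pow_le _ _).trans (by simp at hk; omega)
  · have h := Complex.taylorSeries_eq_of_entire' 0 t hg
    rw [tsum_eq_sum (s := Finset.range (m + 1)) fun k hk => ?_] at h
    · rw [← h, Polynomial.eval_finsetSum]
      simp
    · rw [hder k (by simpa using hk)]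
      simp

theorem norm_cons_le {n : ℕ} (t : ℂ) (z : Fin n → ℂ) :
    1 + ‖(Fin.cons t z : Fin (n + 1) → ℂ)‖ ≤ (1 + ‖t‖) * (1 + ‖z‖) := by
  have : ‖(Fin.cons t z : Fin (n + 1) → ℂ)‖ ≤ ‖t‖ + ‖z‖ := by
    rw [pi_norm_le_iff_of_nonneg (by positivity)]
    refine Fin.cases ?_ fun i => ?_
    · simp
    · simpa using (norm_le_pi_norm z i).trans (by simp)
  nlinarith [norm_nonneg t, norm_nonneg z]

/-- An entire function of several variables of polynomial growth is a polynomial. In the first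
variable it is a polynomial by the one-variable case, and its coefficients are obtained by
interpolation from finitely many slices, which are polynomials by induction. -/
theorem exists_mvPolynomial_of_growth {n : ℕ} {f : (Fin n → ℂ) → ℂ} (hf : Differentiable ℂ f)
    {C : ℝ} {m : ℕ} (hC : ∀ z, ‖f z‖ ≤ C * (1 + ‖z‖) ^ m) :
    ∃ p : MvPolynomial (Fin n) ℂ, ∀ z, f z = MvPolynomial.eval z p := by
  induction n generalizing C with
  | zero => exact ⟨MvPolynomial.C (f 0), fun z => by simp [Subsingleton.elim z 0]⟩
  | succ n ih =>
    have hC0 : 0 ≤ C := by simpa using (norm_nonneg _).trans (hC 0)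
    have hcons : ∀ (t : ℂ) (z : Fin n → ℂ),
        ‖f (Fin.cons t z)‖ ≤ C * ((1 + ‖t‖) ^ m * (1 + ‖z‖) ^ m) := fun t z => by
      refine (hC _).trans ?_
      rw [← mul_pow]
      gcongr
      exact norm_cons_le t z
    have hslice : ∀ j : ℕ, ∃ p : MvPolynomial (Fin n) ℂ,
        ∀ z, f (Fin.cons (j : ℂ) z) = MvPolynomial.eval z p := fun j => by
      refine ih (f := fun z => f (Fin.cons (j : ℂ) z)) ?_ (C := C * (1 + ‖(j : ℂ)‖) ^ m)
        fun z => ?_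
      · refine hf.comp (differentiable_pi.2 (Fin.cases ?_ fun i => ?_))
        · simp
        · simpa using differentiable_apply i
      · rw [mul_assoc]
        exact hcons _ z
    choose p hp using hslice
    refine ⟨∑ j ∈ Finset.range (m + 1), MvPolynomial.rename Fin.succ (p j) *
      Polynomial.aeval (MvPolynomial.X 0 : MvPolynomial (Fin (n + 1)) ℂ)
        (Lagrange.basis (Finset.range (m + 1)) (fun j : ℕ => (j : ℂ)) j), fun z => ?_⟩
    obtain ⟨q, hq, hqf⟩ := exists_polynomial_of_growth (g := fun t => f (Fin.cons t (Fin.tail z)))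
      (hf.comp (differentiable_pi.2 (Fin.cases (by simp) fun i => by simp)))
      (C := C * (1 + ‖Fin.tail z‖) ^ m) (m := m)
      (fun t => by
        refine (hcons t _).trans_eq ?_
        ring)
    have hinj : Set.InjOn (fun j : ℕ => (j : ℂ)) (Finset.range (m + 1)) :=
      fun a _ b _ h => Nat.cast_injective h
    have hdeg : q.degree < (Finset.range (m + 1)).card := by
      rw [Finset.card_range]
      exact Polynomial.degree_le_natDegree.trans_lt (by exact_mod_cast Nat.lt_succ_of_le hq)
    have hval := hqf (z 0)
    rw [Fin.cons_self_tail] at hval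
    rw [hval, Lagrange.eq_interpolate hinj hdeg, Lagrange.interpolate_apply,
      Polynomial.eval_finsetSum, map_sum]
    refine Finset.sum_congr rfl fun j _ => ?_
    rw [Polynomial.eval_mul, Polynomial.eval_C, ← hqf, hp, map_mul, MvPolynomial.eval_rename]
    congr 1
    rw [← MvPolynomial.coe_aeval_eq_eval, RingHom.coe_coe, ← Polynomial.aeval_algHom_apply]
    simp

/-- A polynomial that grows at most like `‖z‖ ^ m` has degree at most `m`. -/
theorem coeff_eq_zero_of_growth {n : ℕ} {p : MvPolynomial (Fin n) ℂ} {C : ℝ} {m : ℕ}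
    (hC : ∀ z, ‖MvPolynomial.eval z p‖ ≤ C * (1 + ‖z‖) ^ m) (a : Fin n →₀ ℕ) (ha : m < a.degree) :
    p.coeff a = 0 := by
  have hC0 : 0 ≤ C := by simpa using (norm_nonneg _).trans (hC 0)
  suffices h : MvPolynomial.homogeneousComponent a.degree p = 0 by
    have h' := MvPolynomial.coeff_homogeneousComponent a.degree p a
    rw [h] at h'
    simpa using h'.symm
  refine MvPolynomial.funext fun z => ?_
  -- the restriction of `p` to the line through `z`, whose coefficients are the homogeneous
  -- components of `p` at `z`
  set Q : Polynomial ℂ := ∑ d ∈ p.support,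
    Polynomial.C (p.coeff d * ∏ i, z i ^ d i) * Polynomial.X ^ d.degree with hQ
  have hQeval : ∀ t, MvPolynomial.eval (t • z) p = Q.eval t := fun t => by
    rw [hQ, Polynomial.eval_finsetSum, MvPolynomial.eval_eq']
    refine Finset.sum_congr rfl fun d _ => ?_
    simp only [Pi.smul_apply, smul_eq_mul, mul_pow, Finset.prod_mul_distrib,
      Finset.prod_pow_eq_pow_sum, Polynomial.eval_mul, Polynomial.eval_C, Polynomial.eval_pow,
      Polynomial.eval_X, Finsupp.degree_eq_sum]
    ring
  obtain ⟨q, hq, hqe⟩ := exists_polynomial_of_growth (g := fun t => Q.eval t) Q.differentiable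
    (C := C * (1 + ‖z‖) ^ m) (m := m) (fun t => by
      rw [← hQeval]
      refine (hC _).trans ?_
      rw [mul_assoc, ← mul_pow, norm_smul]
      gcongr
      nlinarith [norm_nonneg t, norm_nonneg z])
  have hQq : Q = q := Polynomial.funext hqe
  have hcoeff : Q.coeff a.degree = 0 := by
    rw [hQq]
    exact Polynomial.coeff_eq_zero_of_natDegree_lt (hq.trans_lt ha)
  rw [hQ, Polynomial.finsetSum_coeff] at hcoeff
  rw [MvPolynomial.homogeneousComponent_apply, map_sum, map_zero, ← hcoeff, Finset.sum_filter]
  refine Finset.sum_congr rfl fun d _ => ?_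
  rw [Polynomial.coeff_C_mul, Polynomial.coeff_X_pow]
  by_cases h : d.degree = a.degree
  · simp [h, MvPolynomial.eval_monomial, Finsupp.prod_fintype]
  · simp [h, Ne.symm h]

theorem norm_lift_le {n : ℕ} (z : Fin n → ℂ) : ‖lift z‖ ≤ 1 + ‖z‖ := by
  rw [pi_norm_le_iff_of_nonneg (by positivity)]
  refine Fin.lastCases ?_ fun i => ?_
  · simp [lift]
  · simpa [lift] using (norm_le_pi_norm z i).trans (by simp)

theorem differentiable_lift {n : ℕ} : Differentiable ℂ (lift : (Fin n → ℂ) → _) := by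
  refine differentiable_pi.2 (Fin.lastCases ?_ fun i => ?_)
  · simp [lift]
  · simpa [lift] using differentiable_apply i

theorem smul_lift {n : ℕ} {Z : Fin (n + 1) → ℂ} (hZ : Z (Fin.last n) ≠ 0) :
    Z (Fin.last n) • lift (fun i : Fin n => Z i.castSucc / Z (Fin.last n)) = Z := by
  funext i
  refine Fin.lastCases ?_ (fun i => ?_) i
  · simp [lift]
  · simp [lift]
    field_simp

theorem sections_apply_smul {n m : ℕ} (s : sections n m) {c : ℂ} {Z : Fin (n + 1) → ℂ}
    (hc : c ≠ 0) (hZ : Z ≠ 0) : s.1 (c • Z) = c ^ m * s.1 Z :=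
  s.2.2.1 c Z hc hZ

theorem sections_continuousOn {n m : ℕ} (s : sections n m) : ContinuousOn s.1 {0}ᶜ :=
  s.2.1.continuousOn

theorem differentiable_localExpr {n m : ℕ} (s : sections n m) : Differentiable ℂ (localExpr s) :=
  fun z => ((s.2.1.differentiableAt (isOpen_compl_singleton.mem_nhds (lift_ne_zero z))).comp z
    (differentiable_lift z))

/-- A section is determined by its restriction to the chart `{Zₙ ≠ 0}`, which is dense. -/
theorem eq_zero_of_localExpr_eq_zero {n m : ℕ} (s : sections n m) (h : ∀ z, localExpr s z = 0) :
    s = 0 := by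
  have h1 : ∀ Z : Fin (n + 1) → ℂ, Z (Fin.last n) ≠ 0 → s.1 Z = 0 := fun Z hZ => by
    rw [← smul_lift hZ, sections_apply_smul s hZ (lift_ne_zero _)]
    have := h (fun i : Fin n => Z i.castSucc / Z (Fin.last n))
    rw [localExpr] at this
    rw [this, mul_zero]
  refine Subtype.ext (funext fun Z => ?_)
  change s.1 Z = 0
  by_cases hZ : Z = 0
  · rw [hZ, s.2.2.2]
  by_cases hn : Z (Fin.last n) = 0
  · -- approach `Z` along the line in the direction of the last coordinate
    have hcont : ContinuousAt s.1 (Z + (0 : ℂ) • Pi.single (Fin.last n) 1) := by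
      simpa using (sections_continuousOn s).continuousAt (isOpen_compl_singleton.mem_nhds hZ)
    have hlim : Tendsto (fun t : ℂ => s.1 (Z + t • Pi.single (Fin.last n) 1)) (𝓝[≠] 0)
        (𝓝 (s.1 Z)) := by
      have : Continuous fun t : ℂ => Z + t • (Pi.single (Fin.last n) 1 : Fin (n + 1) → ℂ) := by
        fun_prop
      have h2 := (ContinuousAt.comp (f := fun t : ℂ => Z + t • Pi.single (Fin.last n) 1)
        hcont this.continuousAt).tendsto
      simp only [Function.comp_def, zero_smul, add_zero] at h2
      exact h2.mono_left nhdsWithin_le_nhds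
    refine tendsto_nhds_unique hlim (tendsto_const_nhds.congr' ?_)
    filter_upwards [self_mem_nhdsWithin] with t ht
    rw [h1]
    simpa [hn] using ht
  · exact h1 Z hn

/-- Compactness of `ℙⁿ`, in terms of homogeneous coordinates. -/
theorem exists_bound_on_sphere {n : ℕ} {E : Type*} [SeminormedAddCommGroup E]
    {g : (Fin (n + 1) → ℂ) → E} (hg : ContinuousOn g {0}ᶜ) :
    ∃ C : ℝ, 0 < C ∧ ∀ Z, ‖Z‖ = 1 → ‖g Z‖ ≤ C := by
  have hsub : Metric.sphere (0 : Fin (n + 1) → ℂ) 1 ⊆ {0}ᶜ := fun Z hZ h0 => by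
    rw [Set.mem_singleton_iff] at h0
    simp [h0] at hZ
  obtain ⟨C, hC⟩ := (isCompact_sphere (0 : Fin (n + 1) → ℂ) 1).exists_bound_of_continuousOn
    (hg.mono hsub)
  exact ⟨max C 1, by positivity, fun Z hZ => (hC Z (by simpa using hZ)).trans (le_max_left _ _)⟩

theorem norm_inv_norm_smul {n : ℕ} {Z : Fin (n + 1) → ℂ} (hZ : Z ≠ 0) :
    ‖((‖Z‖⁻¹ : ℝ) : ℂ) • Z‖ = 1 := by
  rw [norm_smul, Complex.norm_real, norm_inv, norm_norm, inv_mul_cancel₀ (norm_ne_zero_iff.2 hZ)]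

theorem exists_sections_bound {n m : ℕ} (s : sections n m) :
    ∃ C : ℝ, 0 < C ∧ ∀ Z, Z ≠ 0 → ‖s.1 Z‖ ≤ C * ‖Z‖ ^ m := by
  obtain ⟨C, hC0, hC⟩ := exists_bound_on_sphere (sections_continuousOn s)
  refine ⟨C, hC0, fun Z hZ => ?_⟩
  have hn : ‖Z‖ ≠ 0 := norm_ne_zero_iff.2 hZ
  have h := hC _ (norm_inv_norm_smul hZ)
  rw [sections_apply_smul s (by simpa using hZ) hZ, norm_mul, norm_pow, Complex.norm_real,
    norm_inv, norm_norm, inv_pow, inv_mul_le_iff₀ (by positivity)] at h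
  linarith

theorem exists_localExpr_bound {n m : ℕ} (s : sections n m) :
    ∃ C : ℝ, ∀ z, ‖localExpr s z‖ ≤ C * (1 + ‖z‖) ^ m := by
  obtain ⟨C, hC0, hC⟩ := exists_sections_bound s
  refine ⟨C, fun z => (hC _ (lift_ne_zero z)).trans ?_⟩
  gcongr
  exact norm_lift_le z

/-- The exponents of the monomials of degree `m` in `n + 1` homogeneous coordinates. -/
abbrev Exponent (n m : ℕ) : Type := {b : Fin (n + 1) → ℕ // ∑ i, b i = m}

instance (n m : ℕ) : Fintype (Exponent n m) :=
  Fintype.subtype (Finset.piAntidiag Finset.univ m) (by simp)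

/-- The section `∏ᵢ Lᵢ ^ bᵢ` of `mH`, where `Lᵢ = ∑ⱼ Aᵢⱼ Zⱼ` are the linear forms given by the rows
of `A`. For `A = 1` this is the monomial `Z ^ b`. The case distinction implements the convention
that sections vanish at the origin, which matters for `m = 0`. -/
def frameSection {n m : ℕ} (A : Matrix (Fin (n + 1)) (Fin (n + 1)) ℂ) (b : Exponent n m) :
    sections n m :=
  ⟨fun Z => if Z = 0 then 0 else ∏ i, (A *ᵥ Z) i ^ b.1 i, by
    have hd : Differentiable ℂ fun Z : Fin (n + 1) → ℂ => ∏ i, (A *ᵥ Z) i ^ b.1 i := by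
      have : ∀ i, Differentiable ℂ fun Z : Fin (n + 1) → ℂ => (A *ᵥ Z) i := fun i => by
        simp only [mulVec, dotProduct]
        fun_prop
      fun_prop
    refine ⟨hd.differentiableOn.congr fun Z hZ => if_neg hZ, fun c Z hc hZ => ?_, if_pos rfl⟩
    simp only [hZ, smul_eq_zero, hc, or_self, if_false, mulVec_smul, Pi.smul_apply, smul_eq_mul,
      mul_pow, Finset.prod_mul_distrib, Finset.prod_pow_eq_pow_sum, b.2]⟩

theorem frameSection_apply {n m : ℕ} (A : Matrix (Fin (n + 1)) (Fin (n + 1)) ℂ)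
    (b : Exponent n m) {Z : Fin (n + 1) → ℂ} (hZ : Z ≠ 0) :
    (frameSection A b).1 Z = ∏ i, (A *ᵥ Z) i ^ b.1 i :=
  if_neg hZ

theorem localExpr_add {n m : ℕ} (s t : sections n m) (z : Fin n → ℂ) :
    localExpr (s + t) z = localExpr s z + localExpr t z := rfl

theorem localExpr_sub {n m : ℕ} (s t : sections n m) (z : Fin n → ℂ) :
    localExpr (s - t) z = localExpr s z - localExpr t z := rfl

theorem localExpr_smul {n m : ℕ} (c : ℂ) (s : sections n m) (z : Fin n → ℂ) :
    localExpr (c • s) z = c * localExpr s z := rfl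

theorem sections_sum_apply {n m : ℕ} {ι : Type*} (S : Finset ι) (s : ι → sections n m)
    (Z : Fin (n + 1) → ℂ) : (∑ i ∈ S, s i).1 Z = ∑ i ∈ S, (s i).1 Z := by
  rw [AddSubmonoidClass.coe_finsetSum, Finset.sum_apply]

/-- Every global section of `mH` is a homogeneous polynomial of degree `m`. -/
theorem span_monomials_eq_top (n m : ℕ) :
    Submodule.span ℂ (Set.range (frameSection (n := n) (m := m) 1)) = ⊤ := by
  rw [eq_top_iff]
  rintro s -
  obtain ⟨C, hC⟩ := exists_localExpr_bound s
  obtain ⟨p, hp⟩ := exists_mvPolynomial_of_growth (differentiable_localExpr s) hC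
  have hdeg : ∀ a : Fin n →₀ ℕ, m < a.degree → p.coeff a = 0 :=
    coeff_eq_zero_of_growth (C := C) fun z => by rw [← hp]; exact hC z
  let e : (Fin n →₀ ℕ) → sections n m := fun a =>
    if h : a.degree ≤ m then frameSection 1 ⟨Fin.snoc (α := fun _ => ℕ) a (m - a.degree), by
      rw [Fin.sum_univ_castSucc]
      simp only [Fin.snoc_castSucc, Fin.snoc_last, ← Finsupp.degree_eq_sum]
      omega⟩ else 0
  have hs : s = ∑ a ∈ p.support, p.coeff a • e a := by
    rw [← sub_eq_zero]
    refine eq_zero_of_localExpr_eq_zero _ fun z => ?_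
    rw [localExpr_sub, sub_eq_zero, hp, MvPolynomial.eval_eq', localExpr, sections_sum_apply]
    refine Finset.sum_congr rfl fun a ha => ?_
    have h : a.degree ≤ m := not_lt.1 fun h => (MvPolynomial.mem_support_iff.1 ha) (hdeg a h)
    change _ = p.coeff a * (e a).1 (lift z)
    simp only [e, h, dif_pos]
    rw [frameSection_apply _ _ (lift_ne_zero z), Fin.prod_univ_castSucc]
    simp [lift]
  rw [hs]
  refine Submodule.sum_mem _ fun a ha => Submodule.smul_mem _ _ ?_
  by_cases h : a.degree ≤ m
  · simp only [e, h, dif_pos]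
    exact Submodule.subset_span ⟨_, rfl⟩
  · simp [e, h]

/-- The pullback of a section of `mH` under the linear automorphism `B` of `ℙⁿ`. -/
def pullback {n m : ℕ} (B : Matrix (Fin (n + 1)) (Fin (n + 1)) ℂ) (hB : IsUnit B.det)
    (s : sections n m) : sections n m :=
  have hne : ∀ Z : Fin (n + 1) → ℂ, Z ≠ 0 → B *ᵥ Z ≠ 0 := fun Z hZ h => hZ <| by
    have := congrArg (B⁻¹ *ᵥ ·) h
    simpa [mulVec_mulVec, nonsing_inv_mul _ hB] using this
  ⟨fun Z => s.1 (B *ᵥ Z), by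
    refine ⟨s.2.1.comp ?_ fun Z hZ => hne Z hZ, fun c Z hc hZ => ?_, by
      simp only [mulVec_zero, s.2.2.2]⟩
    · exact (B.mulVecLin.toContinuousLinearMap.differentiable).differentiableOn
    · simp only [mulVec_smul, sections_apply_smul s hc (hne Z hZ)]⟩

/-- The products of powers of any system of linear coordinates span the sections, by pulling back
the statement for monomials under the inverse automorphism. -/
theorem span_frameSection_eq_top {n : ℕ} (m : ℕ) {A : Matrix (Fin (n + 1)) (Fin (n + 1)) ℂ}
    (hA : IsUnit A.det) :
    Submodule.span ℂ (Set.range (frameSection (m := m) A)) = ⊤ := by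
  rw [eq_top_iff]
  rintro s -
  have hA' : IsUnit A⁻¹.det := by rwa [isUnit_nonsing_inv_det_iff]
  have h : pullback A⁻¹ hA' s ∈ Submodule.span ℂ (Set.range (frameSection 1)) := by
    rw [span_monomials_eq_top]
    trivial
  rw [Submodule.mem_span_range_iff_exists_fun] at h ⊢
  obtain ⟨c, hc⟩ := h
  refine ⟨c, ?_⟩
  rw [← sub_eq_zero]
  refine eq_zero_of_localExpr_eq_zero _ fun z => ?_
  have hne : A *ᵥ lift z ≠ 0 := fun h => lift_ne_zero z <| by
    have := congrArg (A⁻¹ *ᵥ ·) h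
    simpa [mulVec_mulVec, nonsing_inv_mul _ hA] using this
  have h1 := congrArg (fun t : sections n m => t.1 (A *ᵥ lift z)) hc
  have h2 : (pullback A⁻¹ hA' s).1 (A *ᵥ lift z) = s.1 (lift z) := by
    change s.1 (A⁻¹ *ᵥ (A *ᵥ lift z)) = _
    rw [mulVec_mulVec, nonsing_inv_mul _ hA, one_mulVec]
  simp only [h2] at h1
  rw [localExpr_sub, sub_eq_zero, localExpr, localExpr, ← h1, sections_sum_apply,
    sections_sum_apply]
  refine Finset.sum_congr rfl fun b _ => ?_
  change c b * (frameSection A b).1 _ = c b * (frameSection 1 b).1 _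
  rw [frameSection_apply _ _ (lift_ne_zero z), frameSection_apply _ _ hne, one_mulVec]

instance (n m : ℕ) : FiniteDimensional ℂ (sections n m) :=
  Module.finite_def.2 (Submodule.fg_def.2
    ⟨_, Set.finite_range (frameSection 1), span_monomials_eq_top n m⟩)

/-! ### Triangular diagonalization of the Hermitian form -/

/-- Unit lower triangular matrices. -/
structure IsUnitLower {n : ℕ} (A : Matrix (Fin n) (Fin n) ℂ) : Prop where
  diag : ∀ i, A i i = 1
  upper : ∀ i j, i < j → A i j = 0

theorem IsUnitLower.det_eq_one {n : ℕ} {A : Matrix (Fin n) (Fin n) ℂ} (hA : IsUnitLower A) :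
    A.det = 1 := by
  rw [det_of_isLowerTriangular A fun i j h => hA.upper i j (by simpa using h)]
  simp [hA.diag]

/-- A positive definite Hermitian matrix is `Aᴴ D A` with `A` unit lower triangular and `D`
diagonal. Peeling off the first index, the first column of `A` is found by solving a linear system
with the invertible matrix of the remaining indices. -/
theorem exists_unitLower_diagonal (n : ℕ) (P : Matrix (Fin n) (Fin n) ℂ) (hP : P.PosDef) :
    ∃ (A : Matrix (Fin n) (Fin n) ℂ) (D : Fin n → ℝ), IsUnitLower A ∧ (∀ i, 0 < D i) ∧
      P = Aᴴ * diagonal (fun i => (D i : ℂ)) * A := by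
  induction n with
  | zero => exact ⟨1, fun _ => 1, ⟨fun i => i.elim0, fun i => i.elim0⟩, fun i => i.elim0,
      Subsingleton.elim _ _⟩
  | succ n ih =>
    obtain ⟨A, D, hA, hD, hPA⟩ := ih (P.submatrix Fin.succ Fin.succ)
      (hP.submatrix (Fin.succ_injective n))
    have hB : IsUnit (Aᴴ * diagonal (fun i => (D i : ℂ))).det := by
      rw [det_mul, det_conjTranspose, hA.det_eq_one, det_diagonal]
      simpa [Finset.prod_eq_zero_iff] using fun i => (hD i).ne'
    set v : Fin n → ℂ := fun j => P j.succ 0 with hv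
    set u : Fin n → ℂ := (Aᴴ * diagonal (fun i => (D i : ℂ)))⁻¹ *ᵥ v with hu
    have huv : (Aᴴ * diagonal (fun i => (D i : ℂ))) *ᵥ u = v := by
      rw [hu, mulVec_mulVec, mul_nonsing_inv _ hB, one_mulVec]
    set d : ℝ := (P 0 0).re - ∑ l, D l * ‖u l‖ ^ 2 with hd
    set A' : Matrix (Fin (n + 1)) (Fin (n + 1)) ℂ :=
      of (Fin.cons (Fin.cons 1 0) fun i => Fin.cons (u i) (A i)) with hA'
    set D' : Fin (n + 1) → ℝ := Fin.cons d D with hD'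
    have hA'l : IsUnitLower A' := by
      constructor
      · refine Fin.cases ?_ fun i => ?_
        · simp [hA']
        · simp [hA', hA.diag]
      · refine fun i => Fin.cases (by simp) (fun j => ?_)
        refine Fin.cases (motive := fun i => i < j.succ → A' i j.succ = 0) ?_ (fun i h => ?_) i
        · simp [hA']
        · simpa [hA'] using hA.upper i j (by simpa using h)
    have h00 : ((P 0 0).re : ℂ) = P 0 0 := by
      have := hP.1.apply 0 0
      exact Complex.conj_eq_iff_re.1 this
    -- the defining property of `u`: it produces the first column of `P`
    have hcol : ∀ j, ∑ l, star (A l j) * D l * u l = P j.succ 0 := fun j => by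
      have := congrFun huv j
      rw [← show v j = P j.succ 0 from rfl, ← this, mulVec, dotProduct]
      simp [mul_diagonal]
    have hPA' : P = A'ᴴ * diagonal (fun i => (D' i : ℂ)) * A' := by
      ext j k
      rw [mul_apply]
      simp only [mul_diagonal, conjTranspose_apply, Fin.sum_univ_succ]
      refine Fin.cases ?_ (fun j => ?_) j <;> refine Fin.cases ?_ (fun k => ?_) k
      · simp only [hA', hD', of_apply, Fin.cons_zero, Fin.cons_succ, star_one, one_mul, mul_one]
        rw [hd]
        push_cast
        rw [h00, sub_add, eq_comm, sub_eq_self, sub_eq_zero]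
        refine Finset.sum_congr rfl fun l _ => ?_
        rw [mul_right_comm, mul_comm]
        congr 1
        exact (Complex.conj_mul' _).symm
      · have := congrArg star (hcol k)
        simp only [hA', hD', of_apply, Fin.cons_zero, Fin.cons_succ]
        rw [hP.1.apply] at this
        simp only [Pi.zero_apply, mul_zero, zero_add]
        rw [← this, star_sum]
        refine Finset.sum_congr rfl fun l _ => ?_
        simp
        ring
      · simpa [hA', hD'] using (hcol j).symm
      · have := congrFun (congrFun hPA j) k
        rw [mul_apply] at this
        simp only [mul_diagonal, conjTranspose_apply, submatrix_apply] at this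
        simpa [hA', hD'] using this
    refine ⟨A', D', hA'l, ?_, hPA'⟩
    -- positivity of the new diagonal entry is inherited from `P` by congruence
    have hunit : IsUnit A' := by
      rw [isUnit_iff_isUnit_det, hA'l.det_eq_one]
      exact isUnit_one
    have hpd : (diagonal (fun i => (D' i : ℂ))).PosDef := by
      rw [hPA'] at hP
      exact (Matrix.IsUnit.posDef_star_left_conjugate_iff hunit).1 hP
    intro i
    have := posDef_diagonal_iff.1 hpd i
    exact_mod_cast this

theorem trailingMinor_eq_prod {n : ℕ} {P A : Matrix (Fin (n + 1)) (Fin (n + 1)) ℂ}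
    {D : Fin (n + 1) → ℝ} (hA : IsUnitLower A)
    (hPA : P = Aᴴ * diagonal (fun i => (D i : ℂ)) * A) (i : ℕ) :
    trailingMinor P i = ∏ j : {j : Fin (n + 1) // i ≤ (j : ℕ)}, D j := by
  set f : {j : Fin (n + 1) // i ≤ (j : ℕ)} → Fin (n + 1) := Subtype.val with hf
  have hsub : P.submatrix f f =
      (A.submatrix f f)ᴴ * diagonal (fun j => (D (f j) : ℂ)) * A.submatrix f f := by
    ext j k
    rw [submatrix_apply, hPA, mul_apply, mul_apply]
    simp only [mul_diagonal, conjTranspose_apply, submatrix_apply]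
    rw [← Finset.sum_subtype (Finset.univ.filter fun l : Fin (n + 1) => i ≤ (l : ℕ)) (by simp)
      (fun l => star (A l (f j)) * (D l : ℂ) * A l (f k)), eq_comm]
    refine Finset.sum_subset (Finset.subset_univ _) fun l _ hl => ?_
    -- rows above `i` of the lower triangular matrix `A` vanish in the columns from `i` on
    have hlj : l < f j := by
      have := j.2
      rw [Fin.lt_def]
      simp only [Finset.mem_filter, Finset.mem_univ, true_and] at hl
      simp only [hf]
      omega
    rw [hA.upper _ _ hlj]
    simp
  have hdet : (A.submatrix f f).det = 1 := by
    rw [det_of_isLowerTriangular (A.submatrix f f) fun j k h => hA.upper (f j) (f k)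
      (Subtype.coe_lt_coe.2 (by simpa using h))]
    simp [hA.diag]
  rw [trailingMinor, ← hf, hsub, det_mul, det_mul, det_conjTranspose, hdet, det_diagonal]
  simp [← Complex.ofReal_prod]

theorem minorRatio_eq {n : ℕ} {P A : Matrix (Fin (n + 1)) (Fin (n + 1)) ℂ}
    {D : Fin (n + 1) → ℝ} (hA : IsUnitLower A) (hD : ∀ i, 0 < D i)
    (hPA : P = Aᴴ * diagonal (fun i => (D i : ℂ)) * A) (i : Fin (n + 1)) :
    minorRatio P i = D i := by
  have hprod : ∀ k : ℕ, trailingMinor P k =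
      ∏ j ∈ Finset.univ.filter fun j : Fin (n + 1) => k ≤ j, D j := fun k => by
    rw [trailingMinor_eq_prod hA hPA,
      Finset.prod_subtype (p := fun j : Fin (n + 1) => k ≤ (j : ℕ))]
    simp
  have hins : (Finset.univ.filter fun j : Fin (n + 1) => (i : ℕ) ≤ j) =
      insert i (Finset.univ.filter fun j : Fin (n + 1) => (i : ℕ) + 1 ≤ j) := by
    ext j
    simp [Fin.ext_iff]
    omega
  rw [minorRatio, hprod, hprod, hins, Finset.prod_insert (by simp), mul_div_assoc, div_self,
    mul_one]
  exact (Finset.prod_pos fun j _ => hD j).ne'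

theorem hermForm_eq_sum {n : ℕ} {P A : Matrix (Fin (n + 1)) (Fin (n + 1)) ℂ}
    {D : Fin (n + 1) → ℝ} (hPA : P = Aᴴ * diagonal (fun i => (D i : ℂ)) * A)
    (Z : Fin (n + 1) → ℂ) : hermForm P Z = ∑ i, D i * ‖(A *ᵥ Z) i‖ ^ 2 := by
  have h : star Z ⬝ᵥ (P *ᵥ Z) =
      star (A *ᵥ Z) ⬝ᵥ (diagonal (fun i => (D i : ℂ)) *ᵥ (A *ᵥ Z)) := by
    rw [hPA, star_mulVec, ← dotProduct_mulVec, mulVec_mulVec, mulVec_mulVec,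
      Matrix.mul_assoc]
  rw [hermForm, h, dotProduct, Complex.re_sum]
  refine Finset.sum_congr rfl fun i _ => ?_
  rw [mulVec_diagonal, Pi.star_apply, mul_left_comm]
  have : star ((A *ᵥ Z) i) * (A *ᵥ Z) i = ((‖(A *ᵥ Z) i‖ ^ 2 : ℝ) : ℂ) := by
    push_cast
    exact Complex.conj_mul' _
  rw [this, ← Complex.ofReal_mul, Complex.ofReal_re]

/-! ### Valuations and the Okounkov body -/

/-- The linear form given by the row `i` of `A`, as an affine function in the standard chart. -/
def rowPolynomial {n : ℕ} (A : Matrix (Fin (n + 1)) (Fin (n + 1)) ℂ) (i : Fin (n + 1)) :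
    MvPolynomial (Fin n) ℂ :=
  MvPolynomial.C (A i (Fin.last n)) +
    ∑ j : Fin n, MvPolynomial.C (A i j.castSucc) * MvPolynomial.X j

/-- The exponent of the dehomogenized monomial, which omits the last coordinate. -/
def Exponent.affine {n m : ℕ} (b : Exponent n m) : Fin n → ℕ := fun i => b.1 i.castSucc

theorem Exponent.affine_injective {n m : ℕ} :
    Function.Injective (Exponent.affine : Exponent n m → Fin n → ℕ) := by
  intro b c h
  refine Subtype.ext (funext (Fin.lastCases ?_ fun i => congrFun h i))
  have hb := b.2
  have hc := c.2
  rw [Fin.sum_univ_castSucc] at hb hc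
  have : ∑ i : Fin n, b.1 i.castSucc = ∑ i : Fin n, c.1 i.castSucc :=
    Finset.sum_congr rfl fun i _ => congrFun h i
  omega

/-- The homogeneous exponent of degree `m` with a given affine part. -/
def Exponent.ofAffine {n m : ℕ} (β : Fin n → ℕ) (hβ : ∑ i, β i ≤ m) : Exponent n m :=
  ⟨Fin.snoc (α := fun _ => ℕ) β (m - ∑ i, β i), by
    rw [Fin.sum_univ_castSucc]
    simp only [Fin.snoc_castSucc, Fin.snoc_last]
    omega⟩

theorem Exponent.affine_ofAffine {n m : ℕ} (β : Fin n → ℕ) (hβ : ∑ i, β i ≤ m) :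
    (Exponent.ofAffine β hβ).affine = β := by
  funext i
  simp [Exponent.affine, Exponent.ofAffine]

theorem Exponent.sum_affine_le {n m : ℕ} (b : Exponent n m) : ∑ i, b.affine i ≤ m := by
  have hb := b.2
  rw [Fin.sum_univ_castSucc] at hb
  simp only [Exponent.affine]
  omega

theorem eval_rowPolynomial {n : ℕ} (A : Matrix (Fin (n + 1)) (Fin (n + 1)) ℂ) (i : Fin (n + 1))
    (z : Fin n → ℂ) : MvPolynomial.eval z (rowPolynomial A i) = (A *ᵥ lift z) i := by
  simp [rowPolynomial, mulVec, dotProduct, Fin.sum_univ_castSucc, lift, add_comm]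

theorem localExpr_frameSection {n m : ℕ} (A : Matrix (Fin (n + 1)) (Fin (n + 1)) ℂ)
    (b : Exponent n m) (z : Fin n → ℂ) : localExpr (frameSection A b) z =
      MvPolynomial.eval z (∏ i, rowPolynomial A i ^ b.1 i) := by
  rw [localExpr, frameSection_apply _ _ (lift_ne_zero z), map_prod]
  simp [eval_rowPolynomial]

theorem coeff_rowPolynomial {n : ℕ} (A : Matrix (Fin (n + 1)) (Fin (n + 1)) ℂ) (i : Fin (n + 1))
    (a : Fin n →₀ ℕ) : (rowPolynomial A i).coeff a =
      (if 0 = a then A i (Fin.last n) else 0) +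
        ∑ j : Fin n, if Finsupp.single j 1 = a then A i j.castSucc else 0 := by
  rw [rowPolynomial, MvPolynomial.coeff_add, MvPolynomial.coeff_C, MvPolynomial.coeff_sum]
  simp [MvPolynomial.coeff_C_mul, MvPolynomial.coeff_X]

/-- The `k`-th linear form is `zₖ` plus a combination of the `zⱼ` with `j < k`; these are
lexicographically larger, since the exponent of an earlier variable counts first. -/
theorem IsUnitLower.hasLexLead_castSucc {n : ℕ} {A : Matrix (Fin (n + 1)) (Fin (n + 1)) ℂ}
    (hA : IsUnitLower A) (k : Fin n) :
    HasLexLead (rowPolynomial A k.castSucc) (Finsupp.single k 1) := by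
  constructor
  · rw [coeff_rowPolynomial, Finset.sum_eq_single k]
    · simp [hA.diag, eq_comm]
    · intro j _ hj
      rw [if_neg]
      exact fun h => hj ((Finsupp.single_left_inj one_ne_zero).1 h)
    · simp
  · intro a ha
    rw [coeff_rowPolynomial, hA.upper _ _ (Fin.castSucc_lt_last k), ite_self, zero_add]
    refine Finset.sum_eq_zero fun j _ => ?_
    split_ifs with h
    · subst h
      refine hA.upper _ _ ?_
      rw [Fin.castSucc_lt_castSucc_iff]
      obtain ⟨l, hl, hl'⟩ := Finsupp.Lex.lt_iff.1 ha
      by_contra hjk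
      simp only [ofLex_toLex, Finsupp.single_apply] at hl hl'
      by_cases hkl : k = l
      · subst hkl
        rcases (not_lt.1 hjk).eq_or_lt with h | h
        · simp [h] at hl'
        · have := hl j h
          simp [h.ne'] at this
      · simp [hkl] at hl'
    · rfl

/-- In the chart `{Zₙ ≠ 0}` the last linear form has constant term `1`. -/
theorem IsUnitLower.hasLexLead_last {n : ℕ} {A : Matrix (Fin (n + 1)) (Fin (n + 1)) ℂ}
    (hA : IsUnitLower A) : HasLexLead (rowPolynomial A (Fin.last n)) 0 := by
  constructor
  · rw [coeff_rowPolynomial, hA.diag]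
    simp
  · intro a ha
    obtain ⟨l, -, hl⟩ := Finsupp.Lex.lt_iff.1 ha
    simp at hl

/-- In the frame given by a unit lower triangular matrix, the leading terms are the same as for
the monomials. -/
theorem IsUnitLower.hasLexLead {n m : ℕ} {A : Matrix (Fin (n + 1)) (Fin (n + 1)) ℂ}
    (hA : IsUnitLower A) (b : Exponent n m) :
    HasLexLead (∏ i, rowPolynomial A i ^ b.1 i) (Finsupp.equivFunOnFinite.symm b.affine) := by
  have h := HasLexLead.prod Finset.univ (p := fun i => rowPolynomial A i ^ b.1 i)
    (b := fun i => b.1 i • (Fin.lastCases 0 (fun k => Finsupp.single k 1) i : Fin n →₀ ℕ))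
    fun i _ => by
      refine HasLexLead.pow ?_ _
      refine Fin.lastCases ?_ (fun k => ?_) i
      · simpa using hA.hasLexLead_last
      · simpa using hA.hasLexLead_castSucc k
  convert h using 1
  ext j
  simp [Fin.sum_univ_castSucc, Finsupp.finsetSum_apply, Finsupp.single_apply, Exponent.affine]

/-- The leading Taylor coefficient of a section that is expanded in a triangular frame. -/
theorem IsUnitLower.taylorCoeff_sum {n m : ℕ} {A : Matrix (Fin (n + 1)) (Fin (n + 1)) ℂ}
    (hA : IsUnitLower A) (c : Exponent n m → ℂ) (b : Exponent n m)
    (hc : ∀ a : Exponent n m, toLex a.affine < toLex b.affine → c a = 0) :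
    taylorCoeff (localExpr (∑ a, c a • frameSection A a)) b.affine = c b ∧
      ∀ α : Fin n → ℕ, toLex α < toLex b.affine →
        taylorCoeff (localExpr (∑ a, c a • frameSection A a)) α = 0 := by
  have hloc : localExpr (∑ a, c a • frameSection A a) = fun z =>
      MvPolynomial.eval z (∑ a, c a • ∏ i, rowPolynomial A i ^ a.1 i) := by
    funext z
    rw [localExpr, sections_sum_apply, map_sum]
    refine Finset.sum_congr rfl fun a _ => ?_
    rw [MvPolynomial.smul_eval, ← localExpr_frameSection]
    rfl
  have h := coeff_sum_of_hasLexLead (fun a : Exponent n m => ∏ i, rowPolynomial A i ^ a.1 i)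
    (fun a => Finsupp.equivFunOnFinite.symm a.affine)
    (Finsupp.equivFunOnFinite.symm.injective.comp Exponent.affine_injective)
    (fun a => hA.hasLexLead a) c b hc
  simp only [hloc, taylorCoeff_eval]
  exact ⟨h.1, fun α hα => h.2 _ hα⟩

theorem HasValuation.eq {n m : ℕ} {s : sections n m} {β γ : Fin n → ℕ} (hβ : HasValuation s β)
    (hγ : HasValuation s γ) : β = γ := by
  rcases lt_trichotomy (toLex β) (toLex γ) with h | h | h
  · exact absurd (hγ.2 β h) hβ.1
  · exact toLex.injective h
  · exact absurd (hβ.2 γ h) hγ.1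

theorem IsUnitLower.hasValuation_frameSection {n m : ℕ}
    {A : Matrix (Fin (n + 1)) (Fin (n + 1)) ℂ} (hA : IsUnitLower A) (b : Exponent n m) :
    HasValuation (frameSection A b) b.affine ∧
      taylorCoeff (localExpr (frameSection A b)) b.affine = 1 := by
  classical
  have h := hA.taylorCoeff_sum (fun a => if a = b then 1 else 0) b fun a ha => by
    rw [if_neg]
    rintro rfl
    exact lt_irrefl _ ha
  simp only [ite_smul, one_smul, zero_smul, Finset.sum_ite_eq', Finset.mem_univ, if_true] at h
  exact ⟨⟨by simp [h.1], h.2⟩, h.1⟩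

theorem IsUnitLower.frameSection_mem_monicSections {n m : ℕ}
    {A : Matrix (Fin (n + 1)) (Fin (n + 1)) ℂ} (hA : IsUnitLower A) (b : Exponent n m) :
    frameSection A b ∈ monicSections n m b.affine :=
  hA.hasValuation_frameSection b

theorem IsUnitLower.exists_eq_sum {n m : ℕ} {A : Matrix (Fin (n + 1)) (Fin (n + 1)) ℂ}
    (hA : IsUnitLower A) (s : sections n m) :
    ∃ c : Exponent n m → ℂ, ∑ a, c a • frameSection A a = s := by
  rw [← Submodule.mem_span_range_iff_exists_fun,
    span_frameSection_eq_top m (by rw [hA.det_eq_one]; exact isUnit_one)]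
  trivial

theorem exists_localExpr_eq_eval {n m : ℕ} (s : sections n m) :
    ∃ p : MvPolynomial (Fin n) ℂ, localExpr s = fun z => MvPolynomial.eval z p := by
  obtain ⟨C, hC⟩ := exists_localExpr_bound s
  obtain ⟨p, hp⟩ := exists_mvPolynomial_of_growth (differentiable_localExpr s) hC
  exact ⟨p, funext hp⟩

/-- The Taylor coefficient at the exponent `α`, as a linear functional on sections. -/
def taylorFunctional {n : ℕ} (m : ℕ) (α : Fin n → ℕ) : sections n m →ₗ[ℂ] ℂ where
  toFun s := taylorCoeff (localExpr s) α
  map_add' s t := by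
    obtain ⟨p, hp⟩ := exists_localExpr_eq_eval s
    obtain ⟨q, hq⟩ := exists_localExpr_eq_eval t
    have h : localExpr (s + t) = fun z => MvPolynomial.eval z (p + q) := by
      funext z
      rw [localExpr_add, hp, hq, map_add]
    rw [h, hp, hq]
    simp only [taylorCoeff_eval, MvPolynomial.coeff_add]
  map_smul' c s := by
    obtain ⟨p, hp⟩ := exists_localExpr_eq_eval s
    have h : localExpr (c • s) = fun z => MvPolynomial.eval z (c • p) := by
      funext z
      rw [localExpr_smul, hp, MvPolynomial.smul_eval]
    rw [h, hp]
    simp only [taylorCoeff_eval, MvPolynomial.coeff_smul, RingHom.id_apply]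

theorem taylorCoeff_localExpr_zero {n m : ℕ} (α : Fin n → ℕ) :
    taylorCoeff (localExpr (0 : sections n m)) α = 0 :=
  (taylorFunctional m α).map_zero

/-- In the expansion of a section in a triangular frame, the coefficient at its valuation is its
leading Taylor coefficient. -/
theorem IsUnitLower.coeff_of_hasValuation {n m : ℕ} {A : Matrix (Fin (n + 1)) (Fin (n + 1)) ℂ}
    (hA : IsUnitLower A) (c : Exponent n m → ℂ) {β : Fin n → ℕ}
    (hβ : HasValuation (∑ a, c a • frameSection A a) β) :
    ∃ b : Exponent n m, b.affine = β ∧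
      c b = taylorCoeff (localExpr (∑ a, c a • frameSection A a)) β := by
  classical
  have hne : (Finset.univ.filter fun a => c a ≠ 0).Nonempty := by
    by_contra h
    rw [Finset.not_nonempty_iff_eq_empty, Finset.filter_eq_empty_iff] at h
    have h0 : ∀ a, c a = 0 := fun a => by simpa using h (Finset.mem_univ a)
    refine hβ.1 ?_
    simp only [h0, zero_smul, Finset.sum_const_zero]
    exact taylorCoeff_localExpr_zero β
  obtain ⟨b, hb, hmin⟩ := Finset.exists_min_image _ (fun a => toLex a.affine) hne
  have h := hA.taylorCoeff_sum c b fun a ha => by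
    by_contra hca
    exact absurd (hmin a (by simpa using hca)) (not_le.2 ha)
  have hval : HasValuation (∑ a, c a • frameSection A a) b.affine :=
    ⟨by rw [h.1]; simpa using hb, h.2⟩
  have hbβ := hval.eq hβ
  exact ⟨b, hbβ, by rw [← hbβ, h.1]⟩

theorem isUnitLower_one {n : ℕ} : IsUnitLower (1 : Matrix (Fin n) (Fin n) ℂ) :=
  ⟨fun _ => one_apply_eq _, fun _ _ h => one_apply_ne h.ne⟩

theorem valuations_eq (n m : ℕ) : valuations n m = {β | ∑ i, β i ≤ m} := by
  ext β
  constructor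
  · rintro ⟨s, -, hs⟩
    obtain ⟨c, rfl⟩ := isUnitLower_one.exists_eq_sum s
    obtain ⟨b, rfl, -⟩ := isUnitLower_one.coeff_of_hasValuation c hs
    exact b.sum_affine_le
  · intro hβ
    have h := isUnitLower_one.hasValuation_frameSection (Exponent.ofAffine β hβ)
    rw [Exponent.affine_ofAffine] at h
    refine ⟨_, ?_, h.1⟩
    intro h0
    have h2 := h.2
    rw [h0, taylorCoeff_localExpr_zero] at h2
    simp at h2

/-- Rounding down `m α` gives approximating exponents for every point `α` of the simplex. -/
theorem exists_approximates {n : ℕ} {α : Fin n → ℝ} (hα : ∀ i, 0 ≤ α i) (hα1 : ∑ i, α i ≤ 1) :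
    Approximates α (fun k => k + 1) (fun k i => ⌊α i * ((k + 1 : ℕ) : ℝ)⌋₊) := by
  refine ⟨fun a b h => Nat.succ_lt_succ h, fun k => ?_, tendsto_pi_nhds.2 fun i => ?_⟩
  · rw [valuations_eq, Set.mem_ofPred_eq, ← Nat.cast_le (α := ℝ)]
    push_cast
    calc ∑ i, (⌊α i * ((k : ℝ) + 1)⌋₊ : ℝ) ≤ ∑ i, α i * ((k : ℝ) + 1) :=
          Finset.sum_le_sum fun i _ => Nat.floor_le (mul_nonneg (hα i) (by positivity))
      _ = (∑ i, α i) * ((k : ℝ) + 1) := by rw [Finset.sum_mul]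
      _ ≤ (k : ℝ) + 1 := mul_le_of_le_one_left (by positivity) hα1
  · have h := (tendsto_nat_floor_mul_div_atTop (hα i)).comp
      (tendsto_natCast_atTop_atTop.comp (tendsto_add_atTop_nat 1))
    exact h

theorem okounkovBody_eq (n : ℕ) :
    okounkovBody n = {α : Fin n → ℝ | (∀ i, 0 ≤ α i) ∧ ∑ i, α i ≤ 1} := by
  apply Set.Subset.antisymm
  · refine closure_minimal (Set.iUnion₂_subset fun m hm => ?_) ?_
    · rintro _ ⟨β, hβ, rfl⟩
      rw [valuations_eq] at hβ
      refine ⟨fun i => by positivity, ?_⟩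
      rw [← Finset.sum_div, div_le_one (by exact_mod_cast hm)]
      exact_mod_cast hβ
    · simp only [Set.ofPred_and, Set.ofPred_forall]
      refine (isClosed_iInter fun i => isClosed_le continuous_const (continuous_apply i)).inter
        (isClosed_le (by fun_prop) continuous_const)
  · rintro α ⟨hα, hα1⟩
    have h := exists_approximates hα hα1
    refine mem_closure_of_tendsto h.tendsto (Eventually.of_forall fun k => ?_)
    exact Set.mem_iUnion₂.2 ⟨k + 1, by omega, _, h.mem_valuations k, rfl⟩

/-! ### Existence and uniqueness of Chebyshev sections -/

/-- A positive definite Hermitian form on a finite-dimensional space attains its minimum on an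
affine subspace at exactly one point. -/
theorem exists_unique_minimizer {V : Type*} [AddCommGroup V] [Module ℂ V] [FiniteDimensional ℂ V]
    (B : V → V → ℂ) (hsymm : ∀ x y, (starRingEnd ℂ) (B x y) = B y x)
    (hadd : ∀ x y z, B (x + y) z = B x z + B y z) (hsmul : ∀ (c : ℂ) x y, B (c • x) y = c * B x y)
    (hnonneg : ∀ x, 0 ≤ (B x x).re) (hdef : ∀ x, B x x = 0 → x = 0) (W : Submodule ℂ V) (x₀ : V) :
    ∃ x, x - x₀ ∈ W ∧ (∀ y, y - x₀ ∈ W → (B x x).re ≤ (B y y).re) ∧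
      ∀ y, y - x₀ ∈ W → (B y y).re ≤ (B x x).re → y = x := by
  -- Mathlib's inner products are conjugate linear in the first argument, `B` in the second
  let core : InnerProductSpace.Core ℂ V :=
    { inner := fun x y => B y x
      conj_inner_symm := fun x y => hsymm x y
      re_inner_nonneg := fun x => hnonneg x
      add_left := fun x y z => by
        change B z (x + y) = B z x + B z y
        rw [← hsymm, hadd, map_add, hsymm, hsymm]
      smul_left := fun x y c => by
        change B y (c • x) = (starRingEnd ℂ) c * B y x
        rw [← hsymm, hsmul, map_mul, hsymm]
      definite := fun x hx => hdef x hx }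
  let _ : NormedAddCommGroup V := core.toNormedAddCommGroup
  let _ : InnerProductSpace ℂ V := InnerProductSpace.ofCore core.toCore
  have hB : ∀ x : V, (B x x).re = ‖x‖ ^ 2 := fun x =>
    (inner_self_eq_norm_sq (𝕜 := ℂ) x).symm ▸ rfl
  have : CompleteSpace W := FiniteDimensional.complete ℂ W
  -- the minimizer is the component of `x₀` orthogonal to `W`
  set x : V := x₀ - W.starProjection x₀ with hx
  have hxW : x - x₀ ∈ W := by
    rw [hx, sub_sub_cancel_left]
    exact W.neg_mem (W.starProjection_apply_mem x₀)
  have hpyth : ∀ y, y - x₀ ∈ W → ‖y‖ ^ 2 = ‖x‖ ^ 2 + ‖y - x‖ ^ 2 := fun y hy => by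
    have hyx : y - x ∈ W := by
      have := W.sub_mem hy hxW
      rwa [sub_sub_sub_cancel_right] at this
    have horth : inner ℂ x (y - x) = 0 := W.starProjection_inner_eq_zero x₀ _ hyx
    have := norm_add_sq_eq_norm_sq_add_norm_sq_of_inner_eq_zero x (y - x) horth
    rw [add_sub_cancel] at this
    simpa [sq] using this
  refine ⟨x, hxW, fun y hy => ?_, fun y hy hle => ?_⟩
  · rw [hB, hB, hpyth y hy]
    nlinarith [sq_nonneg ‖y - x‖]
  · rw [hB, hB, hpyth y hy] at hle
    have : ‖y - x‖ = 0 := by nlinarith [sq_nonneg ‖y - x‖]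
    exact sub_eq_zero.1 (norm_eq_zero.1 this)

/-- The integrand of `hilb`, as a function of the homogeneous coordinates. -/
def hilbIntegrand {n m : ℕ} (φ : Potential n) (μ : VolumeForm n) (s t : sections n m)
    (Z : Fin (n + 1) → ℂ) : ℂ :=
  s.1 Z * (starRingEnd ℂ) (t.1 Z) * ((Real.exp (-(m : ℝ) * φ.toFun Z) * μ.density Z : ℝ) : ℂ)

theorem continuousOn_hilbIntegrand {n m : ℕ} (φ : Potential n) (μ : VolumeForm n)
    (s t : sections n m) : ContinuousOn (hilbIntegrand φ μ s t) {0}ᶜ := by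
  have h1 := sections_continuousOn s
  have h2 := Complex.continuous_conj.comp_continuousOn (sections_continuousOn t)
  have h3 := (Real.continuous_exp.comp_continuousOn
    (φ.continuousOn_toFun.const_mul (-(m : ℝ)))).mul μ.contDiffOn_density.continuousOn
  exact (h1.mul h2).mul (Complex.continuous_ofReal.comp_continuousOn h3)

theorem norm_hilbIntegrand_smul {n m : ℕ} (φ : Potential n) (μ : VolumeForm n)
    (s t : sections n m) {c : ℂ} {Z : Fin (n + 1) → ℂ} (hc : c ≠ 0) (hZ : Z ≠ 0) :
    ‖hilbIntegrand φ μ s t (c • Z)‖ = (‖c‖ ^ (2 * (n + 1)))⁻¹ * ‖hilbIntegrand φ μ s t Z‖ := by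
  have hc' : 0 < ‖c‖ := norm_pos_iff.2 hc
  have hexp : Real.exp (-(m : ℝ) * (φ.toFun Z + 2 * Real.log ‖c‖)) =
      Real.exp (-(m : ℝ) * φ.toFun Z) * (‖c‖ ^ (2 * m))⁻¹ := by
    rw [mul_add, Real.exp_add, ← Real.exp_log (inv_pos.2 (pow_pos hc' (2 * m))), Real.log_inv,
      Real.log_pow]
    push_cast
    ring_nf
  simp only [hilbIntegrand, sections_apply_smul _ hc hZ, φ.map_smul c Z hc hZ,
    μ.density_smul c Z hc hZ, hexp, norm_mul, norm_pow, Complex.norm_conj, map_mul, map_pow,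
    Complex.norm_real, norm_inv, norm_norm]
  field_simp
  ring

theorem continuous_lift {n : ℕ} : Continuous (lift : (Fin n → ℂ) → _) :=
  differentiable_lift.continuous

theorem one_add_norm_le {n : ℕ} (z : Fin n → ℂ) : 1 + ‖z‖ ≤ 2 * ‖lift z‖ := by
  have h1 : 1 ≤ ‖lift z‖ := by simpa [lift] using norm_le_pi_norm (lift z) (Fin.last n)
  have h2 : ‖z‖ ≤ ‖lift z‖ := (pi_norm_le_iff_of_nonneg (norm_nonneg _)).2 fun i => by
    simpa [lift] using norm_le_pi_norm (lift z) i.castSucc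
  linarith

theorem continuous_hilbIntegrand_lift {n m : ℕ} (φ : Potential n) (μ : VolumeForm n)
    (s t : sections n m) : Continuous fun z => hilbIntegrand φ μ s t (lift z) :=
  (continuousOn_hilbIntegrand φ μ s t).comp_continuous continuous_lift fun z => lift_ne_zero z

/-- The integrand decays like `‖z‖ ^ (-2 (n + 1))`, because it is homogeneous of that degree. -/
theorem integrable_hilbIntegrand {n m : ℕ} (φ : Potential n) (μ : VolumeForm n)
    (s t : sections n m) : Integrable fun z => hilbIntegrand φ μ s t (lift z) := by
  obtain ⟨C, hC0, hC⟩ := exists_bound_on_sphere (continuousOn_hilbIntegrand φ μ s t)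
  have hint : Integrable fun z : Fin n → ℂ => (1 + ‖z‖) ^ (-(2 * ((n : ℝ) + 1))) := by
    refine integrable_one_add_norm ?_
    have : Module.finrank ℝ (Fin n → ℂ) = 2 * n := by
      rw [Module.finrank_pi_fintype]
      simp [mul_comm]
    rw [this]
    push_cast
    linarith
  refine (hint.const_mul (C * 2 ^ (2 * (n + 1)))).mono'
    (continuous_hilbIntegrand_lift φ μ s t).aestronglyMeasurable (Eventually.of_forall fun z => ?_)
  have hne := lift_ne_zero z
  have hl : 0 < ‖lift z‖ := norm_pos_iff.2 hne
  have h1 := hC _ (norm_inv_norm_smul hne)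
  rw [norm_hilbIntegrand_smul φ μ s t (by simpa using hne) hne, Complex.norm_real, norm_inv,
    norm_norm, inv_pow, inv_inv] at h1
  have h2 : (1 + ‖z‖) ^ (-(2 * ((n : ℝ) + 1))) = ((1 + ‖z‖) ^ (2 * (n + 1)))⁻¹ := by
    rw [Real.rpow_neg (by positivity)]
    congr 1
    rw [← Real.rpow_natCast]
    push_cast
    rfl
  have h3 : (1 + ‖z‖) ^ (2 * (n + 1)) ≤ 2 ^ (2 * (n + 1)) * ‖lift z‖ ^ (2 * (n + 1)) := by
    rw [← mul_pow]
    exact pow_le_pow_left₀ (by positivity) (one_add_norm_le z) _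
  rw [h2, ← div_eq_mul_inv, le_div_iff₀ (by positivity)]
  calc ‖hilbIntegrand φ μ s t (lift z)‖ * (1 + ‖z‖) ^ (2 * (n + 1))
      ≤ ‖hilbIntegrand φ μ s t (lift z)‖ * (2 ^ (2 * (n + 1)) * ‖lift z‖ ^ (2 * (n + 1))) := by
        gcongr
    _ = (‖lift z‖ ^ (2 * (n + 1)) * ‖hilbIntegrand φ μ s t (lift z)‖) * 2 ^ (2 * (n + 1)) := by
        ring
    _ ≤ _ := by gcongr

theorem hilb_eq {n m : ℕ} (φ : Potential n) (μ : VolumeForm n) (s t : sections n m) :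
    hilb φ μ s t = ∫ z, hilbIntegrand φ μ s t (lift z) := rfl

theorem hilbIntegrand_self {n m : ℕ} (φ : Potential n) (μ : VolumeForm n) (s : sections n m)
    (Z : Fin (n + 1) → ℂ) : hilbIntegrand φ μ s s Z =
      ((‖s.1 Z‖ ^ 2 * (Real.exp (-(m : ℝ) * φ.toFun Z) * μ.density Z) : ℝ) : ℂ) := by
  rw [hilbIntegrand, Complex.mul_conj']
  push_cast
  ring

theorem normSq_eq {n m : ℕ} (φ : Potential n) (μ : VolumeForm n) (s : sections n m) :
    normSq φ μ s = ∫ z : Fin n → ℂ, ‖localExpr s z‖ ^ 2 *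
      (Real.exp (-(m : ℝ) * φ.weight z) * μ.density (lift z)) := by
  rw [normSq, hilb_eq]
  simp only [hilbIntegrand_self]
  rw [integral_complex_ofReal, Complex.ofReal_re]
  rfl

theorem integrable_normSq {n m : ℕ} (φ : Potential n) (μ : VolumeForm n) (s : sections n m) :
    Integrable fun z : Fin n → ℂ => ‖localExpr s z‖ ^ 2 *
      (Real.exp (-(m : ℝ) * φ.weight z) * μ.density (lift z)) := by
  have h := (integrable_hilbIntegrand φ μ s s).re
  simp only [hilbIntegrand_self, RCLike.re_eq_complex_re, Complex.ofReal_re] at h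
  exact h

theorem normSq_integrand_nonneg {n m : ℕ} (φ : Potential n) (μ : VolumeForm n) (s : sections n m)
    (z : Fin n → ℂ) : 0 ≤ ‖localExpr s z‖ ^ 2 *
      (Real.exp (-(m : ℝ) * φ.weight z) * μ.density (lift z)) :=
  mul_nonneg (sq_nonneg _) (mul_nonneg (Real.exp_pos _).le (μ.density_pos _ (lift_ne_zero z)).le)

theorem normSq_nonneg {n m : ℕ} (φ : Potential n) (μ : VolumeForm n) (s : sections n m) :
    0 ≤ normSq φ μ s := by
  rw [normSq_eq]
  exact integral_nonneg (normSq_integrand_nonneg φ μ s)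

theorem eq_zero_of_normSq_eq_zero {n m : ℕ} (φ : Potential n) (μ : VolumeForm n)
    (s : sections n m) (h : normSq φ μ s = 0) : s = 0 := by
  rw [normSq_eq, integral_eq_zero_iff_of_nonneg (normSq_integrand_nonneg φ μ s)
    (integrable_normSq φ μ s)] at h
  have hcont : Continuous fun z : Fin n → ℂ => ‖localExpr s z‖ ^ 2 *
      (Real.exp (-(m : ℝ) * φ.weight z) * μ.density (lift z)) := by
    have := Complex.continuous_re.comp (continuous_hilbIntegrand_lift φ μ s s)
    simp only [hilbIntegrand_self, Function.comp_def, Complex.ofReal_re] at this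
    exact this
  have h0 := (hcont.ae_eq_iff_eq volume continuous_const).1 h
  refine eq_zero_of_localExpr_eq_zero s fun z => ?_
  have hz : _ = (0 : ℝ) := congrFun h0 z
  have hpos : 0 < Real.exp (-(m : ℝ) * φ.weight z) * μ.density (lift z) :=
    mul_pos (Real.exp_pos _) (μ.density_pos _ (lift_ne_zero z))
  simpa using (mul_eq_zero.1 hz).resolve_right hpos.ne'

/-- Two monic sections differ by an element of the linear space of sections whose Taylor
coefficients vanish up to the exponent `β`. -/
theorem mem_monicSections_iff {n m : ℕ} {β : Fin n → ℕ} {s₀ : sections n m}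
    (h₀ : s₀ ∈ monicSections n m β) (s : sections n m) :
    s ∈ monicSections n m β ↔
      s - s₀ ∈ ⨅ α : {α : Fin n → ℕ // toLex α ≤ toLex β}, (taylorFunctional m α.1).ker := by
  simp only [Submodule.mem_iInf, LinearMap.mem_ker, map_sub, sub_eq_zero]
  obtain ⟨⟨-, h₀lt⟩, h₀1⟩ := h₀
  constructor
  · rintro ⟨⟨-, hlt⟩, h1⟩ ⟨α, hα⟩
    rcases hα.lt_or_eq with h | h
    · exact (hlt α h).trans (h₀lt α h).symm
    · obtain rfl := toLex.injective h
      exact h1.trans h₀1.symm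
  · intro h
    have h1 : taylorCoeff (localExpr s) β = 1 := (h ⟨β, le_rfl⟩).trans h₀1
    exact ⟨⟨by simp [h1], fun α hα => (h ⟨α, hα.le⟩).trans (h₀lt α hα)⟩, h1⟩

/-- Chebyshev sections exist and are unique as soon as there is a monic section at all. -/
theorem exists_unique_isChebyshevSection {n m : ℕ} (φ : Potential n) (μ : VolumeForm n)
    {β : Fin n → ℕ} {s₀ : sections n m} (h₀ : s₀ ∈ monicSections n m β) :
    ∃ s : sections n m, IsChebyshevSection φ μ β s ∧
      ∀ t : sections n m, IsChebyshevSection φ μ β t → t = s := by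
  obtain ⟨s, hs, hmin, huniq⟩ := exists_unique_minimizer (hilb φ μ (m := m))
    (fun s t => by
      rw [hilb_eq, hilb_eq, ← integral_conj]
      congr 1
      funext z
      simp only [hilbIntegrand, map_mul, Complex.conj_conj, Complex.conj_ofReal]
      ring)
    (fun s t u => by
      rw [hilb_eq, hilb_eq, hilb_eq, ← integral_add (integrable_hilbIntegrand φ μ s u)
        (integrable_hilbIntegrand φ μ t u)]
      congr 1
      funext z
      simp only [hilbIntegrand, Submodule.coe_add, Pi.add_apply]
      ring)
    (fun c s t => by
      rw [hilb_eq, hilb_eq, ← integral_const_mul]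
      congr 1
      funext z
      simp only [hilbIntegrand, Submodule.coe_smul, Pi.smul_apply, smul_eq_mul]
      ring)
    (fun s => normSq_nonneg φ μ s)
    (fun s hs => eq_zero_of_normSq_eq_zero φ μ s (by rw [normSq, hs, Complex.zero_re]))
    (⨅ α : {α : Fin n → ℕ // toLex α ≤ toLex β}, (taylorFunctional m α.1).ker) s₀
  simp only [← mem_monicSections_iff h₀] at hs hmin huniq
  exact ⟨s, ⟨hs, hmin⟩, fun t ht => huniq t ht.1 (ht.2 s hs)⟩

/-! ### Comparison of volume forms -/

/-- On the compact space `ℙⁿ` the quotient of two volume forms is bounded. -/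
theorem exists_density_le {n : ℕ} (μ ν : VolumeForm n) :
    ∃ C : ℝ, 0 < C ∧ ∀ Z, Z ≠ 0 → μ.density Z ≤ C * ν.density Z := by
  obtain ⟨C, hC0, hC⟩ := exists_bound_on_sphere (g := fun Z => μ.density Z / ν.density Z)
    (μ.contDiffOn_density.continuousOn.div ν.contDiffOn_density.continuousOn
      fun Z hZ => (ν.density_pos Z hZ).ne')
  refine ⟨C, hC0, fun Z hZ => ?_⟩
  have hc : ((‖Z‖⁻¹ : ℝ) : ℂ) ≠ 0 := by simpa using hZ
  have h := (Real.le_norm_self _).trans (hC _ (norm_inv_norm_smul hZ))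
  rw [μ.density_smul _ Z hc hZ, ν.density_smul _ Z hc hZ, mul_div_mul_left _ _
    (inv_ne_zero (pow_ne_zero _ (norm_ne_zero_iff.2 hc))), div_le_iff₀ (ν.density_pos Z hZ)] at h
  exact h

theorem normSq_le_of_density_le {n m : ℕ} (φ : Potential n) {μ ν : VolumeForm n} {C : ℝ}
    (h : ∀ Z, Z ≠ 0 → μ.density Z ≤ C * ν.density Z) (s : sections n m) :
    normSq φ μ s ≤ C * normSq φ ν s := by
  rw [normSq_eq, normSq_eq, ← integral_const_mul]
  refine integral_mono (integrable_normSq φ μ s) ((integrable_normSq φ ν s).const_mul C)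
    fun z => ?_
  have h1 := h _ (lift_ne_zero z)
  calc _ ≤ ‖localExpr s z‖ ^ 2 *
      (Real.exp (-(m : ℝ) * φ.weight z) * (C * ν.density (lift z))) := by gcongr
    _ = _ := by ring

/-! ### Gaussian integrals -/

theorem integral_norm_pow_mul_exp (k : ℕ) {b : ℝ} (hb : 0 < b) :
    ∫ ζ : ℂ, ‖ζ‖ ^ k * Real.exp (-b * ‖ζ‖ ^ 2) =
      Real.pi * b ^ (-((k : ℝ) + 2) / 2) * Real.Gamma (((k : ℝ) + 2) / 2) := by
  have h := Complex.integral_rpow_mul_exp_neg_mul_rpow (p := 2) (q := k) one_le_two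
    (by linarith [(Nat.cast_nonneg k : (0 : ℝ) ≤ k)]) hb
  rw [mul_div_cancel_left₀ _ (two_ne_zero' ℝ)] at h
  rw [← h]
  simp only [Real.rpow_natCast, Real.rpow_ofNat]

theorem integrable_norm_pow_mul_exp (k : ℕ) {b : ℝ} (hb : 0 < b) :
    Integrable fun ζ : ℂ => ‖ζ‖ ^ k * Real.exp (-b * ‖ζ‖ ^ 2) := by
  -- the integral of a non-integrable function is `0` by convention, but this one is not
  refine not_imp_comm.1 integral_undef ?_
  rw [integral_norm_pow_mul_exp k hb]
  have : 0 < Real.Gamma (((k : ℝ) + 2) / 2) := Real.Gamma_pos_of_pos (by positivity)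
  positivity

theorem integral_norm_sq_pow_mul_exp (k : ℕ) {b : ℝ} (hb : 0 < b) :
    ∫ ζ : ℂ, (‖ζ‖ ^ 2) ^ k * Real.exp (-b * ‖ζ‖ ^ 2) =
      Real.pi * k.factorial / b ^ (k + 1) := by
  have h := integral_norm_pow_mul_exp (2 * k) hb
  simp only [pow_mul] at h
  have e : (((2 * k : ℕ) : ℝ) + 2) / 2 = (k : ℝ) + 1 := by push_cast; ring
  rw [h, neg_div, e, Real.Gamma_nat_eq_factorial, Real.rpow_neg hb.le]
  have : b ^ ((k : ℝ) + 1) = b ^ (k + 1) := by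
    rw [← Real.rpow_natCast]
    push_cast
    rfl
  rw [this]
  ring

/-- The integrand of the Gaussian inner product of `ζ ^ a` and `ζ ^ b` on `ℂ`. -/
def gaussianPairing (d : ℝ) (a b : ℕ) (ζ : ℂ) : ℂ :=
  ζ ^ a * (starRingEnd ℂ) ζ ^ b * (Real.exp (-d * ‖ζ‖ ^ 2) : ℂ)

theorem integrable_gaussianPairing {d : ℝ} (hd : 0 < d) (a b : ℕ) :
    Integrable (gaussianPairing d a b) := by
  refine (integrable_norm_pow_mul_exp (a + b) hd).mono' ?_ (Eventually.of_forall fun ζ => ?_)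
  · refine Continuous.aestronglyMeasurable ?_
    unfold gaussianPairing
    fun_prop
  · simp only [gaussianPairing, norm_mul, norm_pow, Complex.norm_conj, Complex.norm_real,
      Real.norm_eq_abs, Real.abs_exp, pow_add]
    exact le_rfl

/-- Distinct monomials are orthogonal, by rotation invariance. -/
theorem integral_gaussianPairing_of_ne (d : ℝ) {a b : ℕ} (hab : a ≠ b) :
    ∫ ζ, gaussianPairing d a b ζ = 0 := by
  have hab' : (a : ℝ) - b ≠ 0 := sub_ne_zero.2 (by exact_mod_cast hab)
  -- the rotation by the angle `π / (a - b)` multiplies the integrand by `-1`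
  set u : Circle := Circle.exp (Real.pi / (a - b)) with hu
  have hu1 : (u : ℂ) ^ a * (starRingEnd ℂ) (u : ℂ) ^ b = -1 := by
    rw [← Circle.coe_inv_eq_conj, hu, ← Circle.exp_neg, Circle.coe_exp, Circle.coe_exp,
      ← Complex.exp_nat_mul, ← Complex.exp_nat_mul, ← Complex.exp_add, ← Complex.exp_pi_mul_I]
    congr 1
    have : (a : ℂ) - b ≠ 0 := by exact_mod_cast hab'
    push_cast
    field_simp
    ring
  have hrot := (rotation u).measurePreserving.integral_comp
    (rotation u).toHomeomorph.measurableEmbedding (gaussianPairing d a b)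
  have hneg : ∀ ζ, gaussianPairing d a b (rotation u ζ) = -gaussianPairing d a b ζ := fun ζ => by
    simp only [gaussianPairing, rotation_apply, map_mul, mul_pow, norm_mul, Circle.norm_coe,
      one_mul]
    linear_combination (ζ ^ a * (starRingEnd ℂ) ζ ^ b * (Real.exp (-d * ‖ζ‖ ^ 2) : ℂ)) * hu1
  simp only [hneg, integral_neg] at hrot
  exact self_eq_neg.1 hrot.symm

theorem integral_gaussianPairing_self {d : ℝ} (hd : 0 < d) (a : ℕ) :
    ∫ ζ, gaussianPairing d a a ζ = ((Real.pi * a.factorial / d ^ (a + 1) : ℝ) : ℂ) := by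
  rw [← integral_norm_sq_pow_mul_exp a hd, ← integral_complex_ofReal]
  congr 1
  funext ζ
  rw [gaussianPairing, ← mul_pow, Complex.mul_conj']
  push_cast
  rfl

/-- The squared norm of the monomial `w ^ b` for the Gaussian weight `exp (-∑ Dᵢ ‖wᵢ‖²)`. -/
def gaussianMoment {n : ℕ} (D : Fin n → ℝ) (b : Fin n → ℕ) : ℝ :=
  ∏ i, (Real.pi * (b i).factorial / D i ^ (b i + 1))

theorem integral_prod_gaussianPairing {n : ℕ} {D : Fin n → ℝ} (hD : ∀ i, 0 < D i)
    (a b : Fin n → ℕ) [Decidable (a = b)] :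
    ∫ w : Fin n → ℂ, ∏ i, gaussianPairing (D i) (a i) (b i) (w i) =
      if a = b then (gaussianMoment D b : ℂ) else 0 := by
  rw [integral_fintype_prod_volume_eq_prod (fun i => gaussianPairing (D i) (a i) (b i))]
  split_ifs with h
  · subst h
    simp only [integral_gaussianPairing_self (hD _), gaussianMoment, Complex.ofReal_prod]
  · obtain ⟨i, hi⟩ := Function.ne_iff.1 h
    exact Finset.prod_eq_zero (Finset.mem_univ i) (integral_gaussianPairing_of_ne _ hi)

theorem integrable_prod_gaussianPairing {n : ℕ} {D : Fin n → ℝ} (hD : ∀ i, 0 < D i)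
    (a b : Fin n → ℕ) :
    Integrable fun w : Fin n → ℂ => ∏ i, gaussianPairing (D i) (a i) (b i) (w i) :=
  Integrable.fintype_prod fun i => integrable_gaussianPairing (hD i) (a i) (b i)

/-- Parseval's identity for polynomials and a diagonal Gaussian weight. -/
theorem integral_norm_sq_sum_monomials {n : ℕ} {ι : Type*} [Fintype ι] {D : Fin n → ℝ}
    (hD : ∀ i, 0 < D i) (b : ι → Fin n → ℕ) (hb : Function.Injective b) (c : ι → ℂ) :
    ∫ w : Fin n → ℂ, ‖∑ a, c a * ∏ i, w i ^ b a i‖ ^ 2 * Real.exp (-∑ i, D i * ‖w i‖ ^ 2) =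
      ∑ a, ‖c a‖ ^ 2 * gaussianMoment D (b a) := by
  classical
  apply Complex.ofReal_injective
  rw [← integral_complex_ofReal]
  have hexp : ∀ w : Fin n → ℂ,
      ((‖∑ a, c a * ∏ i, w i ^ b a i‖ ^ 2 * Real.exp (-∑ i, D i * ‖w i‖ ^ 2) : ℝ) : ℂ) =
        ∑ a, ∑ a', c a * (starRingEnd ℂ) (c a') *
          ∏ i, gaussianPairing (D i) (b a i) (b a' i) (w i) := fun w => by
    have he : Real.exp (-∑ i, D i * ‖w i‖ ^ 2) = ∏ i, Real.exp (-D i * ‖w i‖ ^ 2) := by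
      rw [← Real.exp_sum, ← Finset.sum_neg_distrib]
      simp only [neg_mul]
    rw [he, Complex.ofReal_mul, Complex.ofReal_pow, ← Complex.mul_conj', map_sum,
      Finset.sum_mul_sum, Finset.sum_mul, Complex.ofReal_prod]
    refine Finset.sum_congr rfl fun a _ => ?_
    rw [Finset.sum_mul]
    refine Finset.sum_congr rfl fun a' _ => ?_
    simp only [gaussianPairing, Finset.prod_mul_distrib, map_mul, map_prod, map_pow]
    ring
  simp only [hexp]
  have hint := fun a a' => (integrable_prod_gaussianPairing hD (b a) (b a')).const_mul
    (c a * (starRingEnd ℂ) (c a'))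
  rw [integral_finsetSum _ fun a _ => integrable_finsetSum _ fun a' _ => hint a a',
    Complex.ofReal_sum]
  refine Finset.sum_congr rfl fun a _ => ?_
  rw [integral_finsetSum _ fun a' _ => hint a a', Finset.sum_eq_single a]
  · rw [integral_const_mul, integral_prod_gaussianPairing hD, if_pos rfl, Complex.mul_conj']
    push_cast
    rfl
  · intro a' _ ha'
    rw [integral_const_mul, integral_prod_gaussianPairing hD,
      if_neg fun h => ha' (hb h).symm, mul_zero]
  · simp

/-! ### From projective to Gaussian integrals -/

/-- A complex linear map scales Lebesgue measure by the squared modulus of its complex determinant,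
which is its real determinant. -/
theorem map_complexLinear_volume {k : ℕ} (L : (Fin k → ℂ) →ₗ[ℂ] (Fin k → ℂ))
    (hL : LinearMap.det L ≠ 0) :
    Measure.map L volume = ENNReal.ofReal ((‖LinearMap.det L‖ ^ 2)⁻¹) • volume := by
  have hdet : LinearMap.det (L.restrictScalars ℝ) = ‖LinearMap.det L‖ ^ 2 := by
    rw [LinearMap.det_restrictScalars, Algebra.norm_complex_apply, Complex.normSq_eq_norm_sq]
  have h := Measure.map_linearMap_addHaar_eq_smul_addHaar (volume : Measure (Fin k → ℂ))
    (f := L.restrictScalars ℝ) (by rw [hdet]; exact pow_ne_zero _ (norm_ne_zero_iff.2 hL))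
  rw [hdet, abs_of_nonneg (by positivity)] at h
  exact h

theorem lintegral_eq_mul_lintegral_smul {k : ℕ} {ζ : ℂ} (hζ : ζ ≠ 0) {f : (Fin k → ℂ) → ENNReal}
    (hf : Measurable f) :
    ∫⁻ y, f y = ENNReal.ofReal ((‖ζ‖ ^ 2) ^ k) * ∫⁻ z, f (ζ • z) := by
  have hdet : LinearMap.det (ζ • (LinearMap.id : (Fin k → ℂ) →ₗ[ℂ] _)) = ζ ^ k := by
    rw [LinearMap.det_smul]
    simp
  have h := map_complexLinear_volume (ζ • (LinearMap.id : (Fin k → ℂ) →ₗ[ℂ] _))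
    (by rw [hdet]; exact pow_ne_zero _ hζ)
  have hmap : ∫⁻ z, f (ζ • z) = ∫⁻ y, f y ∂(Measure.map
      (ζ • (LinearMap.id : (Fin k → ℂ) →ₗ[ℂ] _)) volume) := by
    rw [lintegral_map hf]
    · rfl
    · exact (continuous_const_smul ζ).measurable
  have hpos : 0 < (‖ζ‖ ^ 2) ^ k := by positivity
  rw [hmap, h, lintegral_smul_measure, hdet, norm_pow, pow_right_comm ‖ζ‖ k 2,
    smul_eq_mul, ← mul_assoc, ← ENNReal.ofReal_mul hpos.le, mul_inv_cancel₀ hpos.ne',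
    ENNReal.ofReal_one, one_mul]

/-- The volume form `(Z* P Z) ^ (-(n + 1))`. -/
def fubiniStudyVolume {n : ℕ} (P : Matrix (Fin (n + 1)) (Fin (n + 1)) ℂ) (hP : P.PosDef) :
    VolumeForm n where
  density Z := (hermForm P Z ^ (n + 1))⁻¹
  contDiffOn_density := ((contDiff_hermForm P).pow (n + 1)).contDiffOn.inv fun _ hZ =>
    pow_ne_zero _ (hermForm_pos hP hZ).ne'
  density_pos Z hZ := inv_pos.2 (pow_pos (hermForm_pos hP hZ) _)
  density_smul c Z _ _ := by rw [hermForm_smul, mul_pow, mul_inv, ← pow_mul]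

theorem fubiniStudy_integrand {n m : ℕ} {P : Matrix (Fin (n + 1)) (Fin (n + 1)) ℂ}
    (hP : P.PosDef) (z : Fin n → ℂ) :
    Real.exp (-(m : ℝ) * (fubiniStudy P hP).weight z) * (fubiniStudyVolume P hP).density (lift z) =
      (hermForm P (lift z) ^ (m + n + 1))⁻¹ := by
  have h := hermForm_pos hP (lift_ne_zero z)
  have : Real.exp (-(m : ℝ) * (fubiniStudy P hP).weight z) = (hermForm P (lift z) ^ m)⁻¹ := by
    change Real.exp (-(m : ℝ) * Real.log (hermForm P (lift z))) = _
    rw [neg_mul, Real.exp_neg, Real.exp_nat_mul, Real.exp_log h]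
  rw [this]
  change _ * (hermForm P (lift z) ^ (n + 1))⁻¹ = _
  rw [← mul_inv, ← pow_add, add_assoc]

theorem measurable_section {n m : ℕ} (s : sections n m) : Measurable s.1 :=
  measurable_of_continuousOn_compl_singleton 0 (sections_continuousOn s)

theorem snoc_smul {n : ℕ} (ζ : ℂ) (z : Fin n → ℂ) :
    (Fin.snoc (α := fun _ => ℂ) (ζ • z) ζ : Fin (n + 1) → ℂ) = ζ • lift z := by
  funext i
  refine Fin.lastCases ?_ (fun i => ?_) i <;> simp [lift]

/-- Integrating a section of `mH` against the Gaussian `exp (-Z* P Z)` over `ℂⁿ⁺¹` amounts to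
integrating it over `ℙⁿ`: fibrewise, with `Z = ζ (z, 1)`, the integral over `ζ` is a Gamma
function. -/
theorem lintegral_gaussian_eq {n m : ℕ} {P : Matrix (Fin (n + 1)) (Fin (n + 1)) ℂ}
    (hP : P.PosDef) (s : sections n m) :
    ∫⁻ Z, ENNReal.ofReal (‖s.1 Z‖ ^ 2 * Real.exp (-hermForm P Z)) =
      ENNReal.ofReal (Real.pi * (m + n).factorial) *
        ∫⁻ z : Fin n → ℂ, ENNReal.ofReal
          (‖localExpr s z‖ ^ 2 * (hermForm P (lift z) ^ (m + n + 1))⁻¹) := by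
  set f : (Fin (n + 1) → ℂ) → ENNReal :=
    fun Z => ENNReal.ofReal (‖s.1 Z‖ ^ 2 * Real.exp (-hermForm P Z)) with hf
  have hNc : Continuous (hermForm P) := (contDiff_hermForm P).continuous
  have hfm : Measurable f := by
    refine ENNReal.measurable_ofReal.comp (((measurable_section s).norm.pow_const 2).mul ?_)
    exact (Real.continuous_exp.comp hNc.neg).measurable
  have hsnoc : Continuous fun p : ℂ × (Fin n → ℂ) =>
      (Fin.snoc (α := fun _ => ℂ) p.2 p.1 : Fin (n + 1) → ℂ) := by
    refine continuous_pi (Fin.lastCases ?_ fun i => ?_)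
    · simpa using continuous_fst
    · simpa using! (continuous_apply i).comp continuous_snd
  -- substitute `y = ζ z`
  have hfibre : ∀ ζ : ℂ, ζ ≠ 0 →
      ∫⁻ y : Fin n → ℂ, f (Fin.snoc (α := fun _ => ℂ) y ζ) =
        ∫⁻ z : Fin n → ℂ, ENNReal.ofReal (‖localExpr s z‖ ^ 2) * ENNReal.ofReal
          ((‖ζ‖ ^ 2) ^ (m + n) * Real.exp (-hermForm P (lift z) * ‖ζ‖ ^ 2)) := fun ζ hζ => by
    rw [lintegral_eq_mul_lintegral_smul hζ, ← lintegral_const_mul]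
    · congr 1
      funext z
      rw [snoc_smul, hf]
      simp only [sections_apply_smul s hζ (lift_ne_zero z), hermForm_smul]
      rw [← ENNReal.ofReal_mul (by positivity), ← ENNReal.ofReal_mul (by positivity), localExpr,
        norm_mul, norm_pow]
      congr 1
      have : -(‖ζ‖ ^ 2 * hermForm P (lift z)) = -hermForm P (lift z) * ‖ζ‖ ^ 2 := by ring
      rw [this]
      ring
    · have hc : Continuous fun z : Fin n → ℂ =>
          (Fin.snoc (α := fun _ => ℂ) (ζ • z) ζ : Fin (n + 1) → ℂ) :=
        hsnoc.comp (continuous_const.prodMk (continuous_const_smul ζ))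
      exact hfm.comp hc.measurable
    · have hc : Continuous fun z : Fin n → ℂ =>
          (Fin.snoc (α := fun _ => ℂ) z ζ : Fin (n + 1) → ℂ) :=
        hsnoc.comp (continuous_const.prodMk continuous_id)
      exact hfm.comp hc.measurable
  have hlc : Continuous fun z => localExpr s z := (differentiable_localExpr s).continuous
  have hmp := (volume_preserving_piFinSuccAbove (fun _ : Fin (n + 1) => ℂ) (Fin.last n)).symm
  have hsplit : ∫⁻ Z, f Z = ∫⁻ ζ : ℂ, ∫⁻ y : Fin n → ℂ, f (Fin.snoc (α := fun _ => ℂ) y ζ) := by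
    rw [← hmp.lintegral_comp hfm]
    have h1 : ∀ p : ℂ × (Fin n → ℂ),
        (MeasurableEquiv.piFinSuccAbove (fun _ : Fin (n + 1) => ℂ) (Fin.last n)).symm p =
          Fin.snoc (α := fun _ => ℂ) p.2 p.1 := fun p => Fin.insertNth_last' _ _
    simp only [h1]
    rw [Measure.volume_eq_prod, lintegral_prod]
    exact (hfm.comp hsnoc.measurable).aemeasurable
  have hae : ∀ᵐ ζ : ℂ, ζ ≠ 0 := by
    simp [ae_iff]
  -- integrate over `ζ` first, which gives a value of the Gamma function
  rw [hsplit, lintegral_congr_ae (hae.mono fun ζ hζ => hfibre ζ hζ), lintegral_lintegral_swap]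
  · rw [← lintegral_const_mul]
    · congr 1
      funext z
      have hN := hermForm_pos hP (lift_ne_zero z)
      have hint := integrable_norm_pow_mul_exp (2 * (m + n)) hN
      simp only [pow_mul] at hint
      rw [lintegral_const_mul _ (by fun_prop), ← ofReal_integral_eq_lintegral_ofReal hint
        (Eventually.of_forall fun ζ => by positivity), integral_norm_sq_pow_mul_exp _ hN,
        ← ENNReal.ofReal_mul (by positivity), ← ENNReal.ofReal_mul (by positivity)]
      congr 1
      ring
    · have := hNc.comp continuous_lift
      refine ENNReal.measurable_ofReal.comp (Measurable.mul (by fun_prop) ?_)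
      exact (this.measurable.pow_const _).inv
  · have := hNc.comp continuous_lift
    refine Measurable.aemeasurable ?_
    simp only [Function.uncurry_def]
    refine Measurable.mul (by fun_prop) (ENNReal.measurable_ofReal.comp (Continuous.measurable ?_))
    have h2 : Continuous fun p : ℂ × (Fin n → ℂ) => hermForm P (lift p.2) :=
      this.comp continuous_snd
    fun_prop

theorem normSq_fubiniStudy_eq_integral {n m : ℕ} {P : Matrix (Fin (n + 1)) (Fin (n + 1)) ℂ}
    (hP : P.PosDef) (s : sections n m) :
    Real.pi * (m + n).factorial * normSq (fubiniStudy P hP) (fubiniStudyVolume P hP) s =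
      ∫ Z, ‖s.1 Z‖ ^ 2 * Real.exp (-hermForm P Z) := by
  rw [normSq_eq, integral_eq_lintegral_of_nonneg_ae, integral_eq_lintegral_of_nonneg_ae,
    lintegral_gaussian_eq hP s, ENNReal.toReal_mul, ENNReal.toReal_ofReal (by positivity)]
  · simp only [fubiniStudy_integrand hP]
  · exact Eventually.of_forall fun Z => by positivity
  · refine (((measurable_section s).norm.pow_const 2).mul ?_).aestronglyMeasurable
    exact (Real.continuous_exp.comp (contDiff_hermForm P).continuous.neg).measurable
  · exact Eventually.of_forall (normSq_integrand_nonneg _ _ s)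
  · exact (integrable_normSq _ _ s).aestronglyMeasurable

theorem integral_comp_unitLower {n : ℕ} {A : Matrix (Fin n) (Fin n) ℂ} (hA : IsUnitLower A)
    {f : (Fin n → ℂ) → ℝ} (hf : Continuous f) : ∫ Z, f (A *ᵥ Z) = ∫ w, f w := by
  have hdet : LinearMap.det (Matrix.toLin' A) = 1 := by
    rw [LinearMap.det_toLin', hA.det_eq_one]
  have h := map_complexLinear_volume (Matrix.toLin' A) (by rw [hdet]; exact one_ne_zero)
  rw [hdet] at h
  simp only [norm_one, one_pow, inv_one, ENNReal.ofReal_one, one_smul] at h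
  have hm : AEMeasurable (Matrix.toLin' A) (volume : Measure (Fin n → ℂ)) :=
    (LinearMap.continuous_of_finiteDimensional _).measurable.aemeasurable
  have h2 := integral_map hm (f := f) hf.aestronglyMeasurable
  rw [h] at h2
  rw [h2]
  rfl

/-- In the triangular frame that diagonalizes `P`, the Fubini–Study norm is diagonal. -/
theorem normSq_fubiniStudy_sum {n m : ℕ} {P A : Matrix (Fin (n + 1)) (Fin (n + 1)) ℂ}
    {D : Fin (n + 1) → ℝ} (hP : P.PosDef) (hA : IsUnitLower A) (hD : ∀ i, 0 < D i)
    (hPA : P = Aᴴ * diagonal (fun i => (D i : ℂ)) * A) (c : Exponent n m → ℂ) :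
    Real.pi * (m + n).factorial * normSq (fubiniStudy P hP) (fubiniStudyVolume P hP)
        (∑ b, c b • frameSection A b) = ∑ b, ‖c b‖ ^ 2 * gaussianMoment D b.1 := by
  have hf : Continuous fun w : Fin (n + 1) → ℂ => ‖∑ b : Exponent n m, c b * ∏ i, w i ^ b.1 i‖ ^ 2 *
      Real.exp (-∑ i, D i * ‖w i‖ ^ 2) := by
    fun_prop
  rw [normSq_fubiniStudy_eq_integral, ← integral_norm_sq_sum_monomials hD
    (fun b : Exponent n m => b.1) Subtype.val_injective c, ← integral_comp_unitLower hA hf]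
  refine integral_congr_ae ?_
  have hae : ∀ᵐ Z : Fin (n + 1) → ℂ, Z ≠ 0 := by
    simp [ae_iff]
  filter_upwards [hae] with Z hZ
  rw [hermForm_eq_sum hPA, sections_sum_apply]
  congr 4
  funext b
  change c b * (frameSection A b).1 Z = _
  rw [frameSection_apply A b hZ]

/-! ### Asymptotics -/

/-- A crude form of Stirling's formula, valid also at `k = 0`, where `0 * log 0 = 0`. -/
theorem abs_log_factorial_sub_le (k : ℕ) :
    |Real.log k.factorial - (k * Real.log k - k)| ≤ 1 + Real.log (k + 1) := by
  rcases Nat.eq_zero_or_pos k with rfl | hk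
  · simp
  have hk0 : (0 : ℝ) < k := by exact_mod_cast hk
  have hfac : (0 : ℝ) < k.factorial := by exact_mod_cast k.factorial_pos
  have hlog : Real.log k ≤ Real.log (k + 1) := Real.log_le_log hk0 (by linarith)
  have hlog0 : 0 ≤ Real.log k := Real.log_natCast_nonneg k
  have hlower : k * Real.log k - k ≤ Real.log k.factorial := by
    have h := Real.log_le_log (by positivity) (Real.pow_div_factorial_le_exp k hk0.le k)
    rw [Real.log_exp, Real.log_div (by positivity) hfac.ne', Real.log_pow] at h
    linarith
  have hupper : Real.log k.factorial ≤ k * Real.log k - k + (1 + Real.log (k + 1)) := by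
    -- Stirling's sequence `k! / (√(2k) (k / e) ^ k)` decreases from `k = 1` on
    have h : Real.log (Stirling.stirlingSeq k) ≤ Real.log (Stirling.stirlingSeq 1) := by
      have := Stirling.log_stirlingSeq'_antitone (Nat.zero_le (k - 1))
      simpa [Nat.sub_add_cancel (Nat.succ_le_of_lt hk)] using this
    rw [Stirling.log_stirlingSeq_formula, Stirling.log_stirlingSeq_formula,
      Real.log_div hk0.ne' (Real.exp_pos 1).ne', Real.log_mul two_ne_zero hk0.ne',
      Real.log_exp] at h
    simp at h
    linarith
  rw [abs_le]
  constructor <;> linarith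

theorem log_factorial_add_le (m n : ℕ) :
    Real.log (m + n).factorial ≤ Real.log m.factorial + n * Real.log (m + n + 1) := by
  have h1 : (m + n).factorial ≤ m.factorial * (m + n + 1) ^ n := by
    rw [← Nat.factorial_mul_ascFactorial]
    refine Nat.mul_le_mul_left _ ((Nat.ascFactorial_le_pow_add m n).trans ?_)
    exact Nat.pow_le_pow_left (by omega) _
  have h2 : ((m + n).factorial : ℝ) ≤ m.factorial * ((m : ℝ) + n + 1) ^ n := by exact_mod_cast h1
  have h := Real.log_le_log (by exact_mod_cast (m + n).factorial_pos) h2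
  rwa [Real.log_mul (by exact_mod_cast m.factorial_ne_zero) (by positivity), Real.log_pow] at h

theorem log_gaussianMoment {n : ℕ} {D : Fin n → ℝ} (hD : ∀ i, 0 < D i) (b : Fin n → ℕ) :
    Real.log (gaussianMoment D b) =
      ∑ i, (Real.log Real.pi + Real.log (b i).factorial - (b i + 1) * Real.log (D i)) := by
  have hfac : ∀ i, ((b i).factorial : ℝ) ≠ 0 := fun i => by exact_mod_cast (b i).factorial_ne_zero
  rw [gaussianMoment, Real.log_prod fun i _ => div_ne_zero (mul_ne_zero Real.pi_ne_zero (hfac i))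
    (pow_ne_zero _ (hD i).ne')]
  refine Finset.sum_congr rfl fun i _ => ?_
  rw [Real.log_div (mul_ne_zero Real.pi_ne_zero (hfac i)) (pow_ne_zero _ (hD i).ne'),
    Real.log_mul Real.pi_ne_zero (hfac i), Real.log_pow]
  push_cast
  rfl

theorem gaussianMoment_pos {n : ℕ} {D : Fin n → ℝ} (hD : ∀ i, 0 < D i) (b : Fin n → ℕ) :
    0 < gaussianMoment D b :=
  Finset.prod_pos fun i _ => by
    have := hD i
    positivity

/-- By Stirling's formula, the logarithm of the minimal Fubini–Study norm is, up to an error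
of logarithmic size in `m`, a relative entropy of the rescaled exponent `b / m`. -/
theorem exists_log_norm_bound {n : ℕ} {D : Fin (n + 1) → ℝ} (hD : ∀ i, 0 < D i) :
    ∃ K L : ℝ, ∀ (m : ℕ) (b : Exponent n m), 1 ≤ m →
      |Real.log (gaussianMoment D b.1 / (Real.pi * (m + n).factorial)) -
        m * ∑ i, ((b.1 i / m : ℝ) * Real.log (b.1 i / m) - (b.1 i / m : ℝ) * Real.log (D i))| ≤
      K + L * Real.log (m + n + 1) := by
  refine ⟨|∑ i, (Real.log Real.pi - Real.log (D i)) - Real.log Real.pi| + (n + 2),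
    n + 2 + n, fun m b hm => ?_⟩
  have hm0 : (0 : ℝ) < m := by exact_mod_cast hm
  have hsum : ∑ i, (b.1 i : ℝ) = m := by exact_mod_cast b.2
  have hfac : ((m + n).factorial : ℝ) ≠ 0 := by exact_mod_cast (m + n).factorial_ne_zero
  have hmono : ∀ k : ℕ, k ≤ m → Real.log (k + 1) ≤ Real.log (m + n + 1) := fun k hk => by
    refine Real.log_le_log (by positivity) ?_
    have h1 : (k : ℝ) ≤ m := by exact_mod_cast hk
    have h2 : (0 : ℝ) ≤ n := Nat.cast_nonneg n
    linarith
  -- the error term in Stirling's formula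
  set r : ℕ → ℝ := fun k => Real.log k.factorial - (k * Real.log k - k) with hr
  have hrb : ∀ k ≤ m, |r k| ≤ 1 + Real.log (m + n + 1) := fun k hk =>
    (abs_log_factorial_sub_le k).trans (by linarith [hmono k hk])
  have hble : ∀ i, b.1 i ≤ m := fun i => by
    refine le_of_le_of_eq ?_ b.2
    exact Finset.single_le_sum (fun j _ => Nat.zero_le (b.1 j)) (Finset.mem_univ i)
  -- the main terms of Stirling's formula combine to the entropy
  have hmain : m * ∑ i, ((b.1 i / m : ℝ) * Real.log (b.1 i / m) -
      (b.1 i / m : ℝ) * Real.log (D i)) =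
      ∑ i, ((b.1 i : ℝ) * Real.log (b.1 i) - b.1 i) - ∑ i, (b.1 i : ℝ) * Real.log (D i) -
        (m * Real.log m - m) := by
    have hterm : ∀ i, (m : ℝ) * ((b.1 i / m : ℝ) * Real.log (b.1 i / m) -
        (b.1 i / m : ℝ) * Real.log (D i)) =
        (b.1 i : ℝ) * Real.log (b.1 i) - b.1 i * Real.log m - b.1 i * Real.log (D i) := fun i => by
      by_cases hb : (b.1 i : ℝ) = 0
      · simp [hb]
      · rw [Real.log_div hb hm0.ne']
        field_simp
    rw [Finset.mul_sum, Finset.sum_congr rfl fun i _ => hterm i, Finset.sum_sub_distrib,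
      Finset.sum_sub_distrib, Finset.sum_sub_distrib, ← Finset.sum_mul, hsum]
    ring
  have hsplit : Real.log (gaussianMoment D b.1 / (Real.pi * (m + n).factorial)) -
      m * ∑ i, ((b.1 i / m : ℝ) * Real.log (b.1 i / m) - (b.1 i / m : ℝ) * Real.log (D i)) =
      (∑ i, (Real.log Real.pi - Real.log (D i)) - Real.log Real.pi) + ∑ i, r (b.1 i) - r m -
        (Real.log (m + n).factorial - Real.log m.factorial) := by
    rw [hmain, Real.log_div (gaussianMoment_pos hD _).ne' (mul_ne_zero Real.pi_ne_zero hfac),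
      Real.log_mul Real.pi_ne_zero hfac, log_gaussianMoment hD]
    simp only [hr, Finset.sum_sub_distrib, Finset.sum_add_distrib, add_mul, one_mul]
    ring
  have hr1 : |∑ i, r (b.1 i)| ≤ (n + 1) * (1 + Real.log (m + n + 1)) := by
    refine (Finset.abs_sum_le_sum_abs _ _).trans
      ((Finset.sum_le_sum fun i _ => hrb _ (hble i)).trans_eq ?_)
    simp
    ring
  have hr2 : 0 ≤ Real.log (m + n).factorial - Real.log m.factorial :=
    sub_nonneg.2 (Real.log_le_log (by exact_mod_cast m.factorial_pos)
      (by exact_mod_cast Nat.factorial_le (Nat.le_add_right m n)))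
  have hr3 := log_factorial_add_le m n
  have hr4 := hrb m le_rfl
  rw [hsplit]
  have hc := abs_le.1 (le_refl |∑ i, (Real.log Real.pi - Real.log (D i)) - Real.log Real.pi|)
  rw [abs_le] at hr1 hr4 ⊢
  constructor <;> nlinarith

theorem tendsto_const_add_log_div {K L : ℝ} (n : ℕ) :
    Tendsto (fun m : ℕ => (K + L * Real.log (m + n + 1)) / (m : ℝ)) atTop (𝓝 0) := by
  have h1 : Tendsto (fun m : ℕ => (m : ℝ) + (n + 1)) atTop atTop :=
    tendsto_atTop_add_const_right _ _ tendsto_natCast_atTop_atTop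
  have h2 : (fun m : ℕ => K + L * Real.log ((m : ℝ) + (n + 1))) =o[atTop]
      fun m : ℕ => (m : ℝ) + (n + 1) := by
    refine Asymptotics.IsLittleO.add ?_ (Asymptotics.IsLittleO.const_mul_left ?_ L)
    · exact (Asymptotics.isLittleO_const_id_atTop K).comp_tendsto h1
    · exact Real.isLittleO_log_id_atTop.comp_tendsto h1
  have h3 : (fun m : ℕ => (m : ℝ) + (n + 1)) =O[atTop] fun m : ℕ => (m : ℝ) := by
    refine (Asymptotics.isBigO_refl _ _).add ?_
    exact ((Asymptotics.isLittleO_const_id_atTop ((n : ℝ) + 1)).comp_tendsto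
      tendsto_natCast_atTop_atTop).isBigO
  have h4 := (h2.trans_isBigO h3).tendsto_div_nhds_zero
  simpa only [add_assoc] using h4

/-! ### The Chebyshev potential of the Fubini–Study potential -/

/-- In the orthogonal expansion of a monic section the coefficient at `b` is `1`, so its norm is at
least that of the frame section at `b`. -/
theorem le_normSq_fubiniStudy_of_mem_monicSections {n m : ℕ}
    {P A : Matrix (Fin (n + 1)) (Fin (n + 1)) ℂ} {D : Fin (n + 1) → ℝ} (hP : P.PosDef)
    (hA : IsUnitLower A) (hD : ∀ i, 0 < D i) (hPA : P = Aᴴ * diagonal (fun i => (D i : ℂ)) * A)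
    (b : Exponent n m) {s : sections n m} (hs : s ∈ monicSections n m b.affine) :
    gaussianMoment D b.1 / (Real.pi * (m + n).factorial) ≤
      normSq (fubiniStudy P hP) (fubiniStudyVolume P hP) s := by
  obtain ⟨c, rfl⟩ := hA.exists_eq_sum s
  obtain ⟨b', hb', hc⟩ := hA.coeff_of_hasValuation c hs.1
  obtain rfl := Exponent.affine_injective hb'
  rw [hs.2] at hc
  rw [div_le_iff₀' (by positivity), normSq_fubiniStudy_sum hP hA hD hPA]
  have h := Finset.single_le_sum (f := fun a => ‖c a‖ ^ 2 * gaussianMoment D a.1)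
    (fun a _ => mul_nonneg (sq_nonneg _) (gaussianMoment_pos hD _).le) (Finset.mem_univ b')
  simpa [hc] using h

theorem normSq_fubiniStudy_frameSection {n m : ℕ}
    {P A : Matrix (Fin (n + 1)) (Fin (n + 1)) ℂ} {D : Fin (n + 1) → ℝ} (hP : P.PosDef)
    (hA : IsUnitLower A) (hD : ∀ i, 0 < D i) (hPA : P = Aᴴ * diagonal (fun i => (D i : ℂ)) * A)
    (b : Exponent n m) :
    normSq (fubiniStudy P hP) (fubiniStudyVolume P hP) (frameSection A b) =
      gaussianMoment D b.1 / (Real.pi * (m + n).factorial) := by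
  classical
  have h := normSq_fubiniStudy_sum hP hA hD hPA fun a => if a = b then 1 else 0
  rw [eq_div_iff (by positivity), mul_comm]
  simpa [ite_smul, apply_ite norm, ite_pow, ite_mul] using h

/-- The Chebyshev potential in terms of the diagonal entries `D`, written with the `n + 1`
barycentric coordinates `(α, 1 - ∑ αᵢ)` of the simplex. -/
theorem hasChebyshevPotential_fubiniStudy {n : ℕ} {P A : Matrix (Fin (n + 1)) (Fin (n + 1)) ℂ}
    {D : Fin (n + 1) → ℝ} (hP : P.PosDef) (hA : IsUnitLower A) (hD : ∀ i, 0 < D i)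
    (hPA : P = Aᴴ * diagonal (fun i => (D i : ℂ)) * A) {α : Fin n → ℝ} (hα : ∀ i, 0 ≤ α i)
    (hα1 : ∑ i, α i ≤ 1) :
    HasChebyshevPotential (fubiniStudy P hP) α
      (∑ i, ((Fin.snoc (α := fun _ => ℝ) α (1 - ∑ i, α i) : Fin (n + 1) → ℝ) i *
          Real.log ((Fin.snoc (α := fun _ => ℝ) α (1 - ∑ i, α i) : Fin (n + 1) → ℝ) i) -
        (Fin.snoc (α := fun _ => ℝ) α (1 - ∑ i, α i) : Fin (n + 1) → ℝ) i *
          Real.log (D i))) := by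
  refine ⟨⟨_, _, exists_approximates hα hα1⟩, fun μ m β happ => ?_⟩
  set a : Fin (n + 1) → ℝ := Fin.snoc (α := fun _ => ℝ) α (1 - ∑ i, α i) with ha
  have hβ : ∀ k, ∑ i, β k i ≤ m k := fun k => by
    have := happ.mem_valuations k
    rwa [valuations_eq] at this
  set b : ∀ k, Exponent n (m k) := fun k => Exponent.ofAffine (β k) (hβ k) with hb
  have hbβ : ∀ k, (b k).affine = β k := fun k => Exponent.affine_ofAffine _ _
  have hmonic : ∀ k, frameSection A (b k) ∈ monicSections n (m k) (β k) := fun k => by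
    rw [← hbβ]
    exact hA.frameSection_mem_monicSections (b k)
  choose Ch hCh huniq using fun k =>
    exists_unique_isChebyshevSection (fubiniStudy P hP) μ (hmonic k)
  refine ⟨Ch, fun k => ⟨hCh k, huniq k⟩, ?_⟩
  obtain ⟨C₁, hC₁, h₁⟩ := exists_density_le μ (fubiniStudyVolume P hP)
  obtain ⟨C₂, hC₂, h₂⟩ := exists_density_le (fubiniStudyVolume P hP) μ
  -- the minimal norm for the volume form `(Z* P Z) ^ (-(n + 1))`
  set N : ℕ → ℝ := fun k => gaussianMoment D (b k).1 / (Real.pi * (m k + n).factorial) with hN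
  have hN0 : ∀ k, 0 < N k := fun k => div_pos (gaussianMoment_pos hD _) (by positivity)
  have hlower : ∀ k, N k ≤ C₂ * normSq (fubiniStudy P hP) μ (Ch k) := fun k => by
    refine le_trans ?_ (normSq_le_of_density_le _ h₂ (Ch k))
    refine le_normSq_fubiniStudy_of_mem_monicSections hP hA hD hPA (b k) ?_
    rw [hbβ]
    exact (hCh k).1
  have hupper : ∀ k, normSq (fubiniStudy P hP) μ (Ch k) ≤ C₁ * N k := fun k => by
    refine ((hCh k).2 _ (hmonic k)).trans ((normSq_le_of_density_le _ h₁ _).trans_eq ?_)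
    rw [normSq_fubiniStudy_frameSection hP hA hD hPA]
  have hpos : ∀ k, 0 < normSq (fubiniStudy P hP) μ (Ch k) := fun k =>
    pos_of_mul_pos_right ((hN0 k).trans_le (hlower k)) hC₂.le
  have hmtop : Tendsto m atTop atTop := happ.strictMono.tendsto_atTop
  -- `m 0 = 0` is possible, so the quotients are meaningful only from some index on
  have hmpos : ∀ᶠ k in atTop, 1 ≤ m k := hmtop.eventually_ge_atTop 1
  obtain ⟨K, L, hKL⟩ := exists_log_norm_bound hD
  set x : ℕ → Fin (n + 1) → ℝ := fun k i => ((b k).1 i : ℝ) / m k with hx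
  have hxlim : ∀ i, Tendsto (fun k => x k i) atTop (𝓝 (a i)) := by
    have hinit := fun i => tendsto_pi_nhds.1 happ.tendsto i
    refine Fin.lastCases ?_ fun i => ?_
    · rw [ha, Fin.snoc_last]
      have := (tendsto_finsetSum Finset.univ fun i _ => hinit i).const_sub 1
      refine this.congr' ?_
      filter_upwards [hmpos] with k hk
      have hk0 : (m k : ℝ) ≠ 0 := by
        have : m k ≠ 0 := by omega
        exact_mod_cast this
      simp only [hx, hb, Exponent.ofAffine, Fin.snoc_last]
      rw [Nat.cast_sub (hβ k), ← Finset.sum_div, sub_div, div_self hk0]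
      push_cast
      rfl
    · rw [ha, Fin.snoc_castSucc]
      refine (hinit i).congr fun k => ?_
      simp [hx, hb, Exponent.ofAffine]
  have hent : Tendsto (fun k => ∑ i, (x k i * Real.log (x k i) - x k i * Real.log (D i))) atTop
      (𝓝 (∑ i, (a i * Real.log (a i) - a i * Real.log (D i)))) := by
    refine tendsto_finsetSum _ fun i _ => Tendsto.sub ?_ ((hxlim i).mul_const _)
    exact (Real.continuous_mul_log.tendsto (a i)).comp (hxlim i)
  have herr : Tendsto (fun k => 1 / (m k : ℝ) * Real.log (normSq (fubiniStudy P hP) μ (Ch k)) -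
      ∑ i, (x k i * Real.log (x k i) - x k i * Real.log (D i))) atTop (𝓝 0) := by
    refine squeeze_zero_norm' ?_ ((tendsto_const_add_log_div (K := K + |Real.log C₁| +
      |Real.log C₂|) (L := L) n).comp hmtop)
    filter_upwards [hmpos] with k hk
    have hk0 : (0 : ℝ) < m k := by exact_mod_cast hk
    have hb1 := hKL (m k) (b k) hk
    have hl := Real.log_le_log (hN0 k) (hlower k)
    rw [Real.log_mul hC₂.ne' (hpos k).ne'] at hl
    have hu := Real.log_le_log (hpos k) (hupper k)
    rw [Real.log_mul hC₁.ne' (hN0 k).ne'] at hu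
    have h1 := le_abs_self (Real.log C₁)
    have h2 := le_abs_self (Real.log C₂)
    have h3 := abs_nonneg (Real.log C₁)
    have h4 := abs_nonneg (Real.log C₂)
    set S := ∑ i, (x k i * Real.log (x k i) - x k i * Real.log (D i)) with hS
    have hb2 : |Real.log (N k) - m k * S| ≤ K + L * Real.log (m k + n + 1) := hb1
    rw [Function.comp_apply, Real.norm_eq_abs, le_div_iff₀ hk0, ← abs_of_pos hk0, ← abs_mul,
      abs_of_pos hk0, sub_mul, mul_comm (1 / (m k : ℝ)), mul_assoc, one_div,
      inv_mul_cancel₀ hk0.ne', mul_one, mul_comm S]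
    rw [abs_le] at hb2 ⊢
    constructor <;> linarith
  have := herr.add hent
  simpa using this

end Chebyshev

end

theorem theorem1 (n : ℕ) (P : Matrix (Fin (n + 1)) (Fin (n + 1)) ℂ) (hP : P.PosDef) :
    Chebyshev.okounkovBody n = {α : Fin n → ℝ | (∀ i, 0 ≤ α i) ∧ ∑ i, α i ≤ 1} ∧
    ∀ α ∈ Chebyshev.okounkovBody n,
      Chebyshev.HasChebyshevPotential (Chebyshev.fubiniStudy P hP) α
        (∑ i : Fin n, α i * Real.log (α i / Chebyshev.minorRatio P i) +
          (1 - ∑ i : Fin n, α i) *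
            Real.log ((1 - ∑ i : Fin n, α i) / Chebyshev.minorRatio P n)) := by
  refine ⟨Chebyshev.okounkovBody_eq n, fun α hα => ?_⟩
  rw [Chebyshev.okounkovBody_eq] at hα
  obtain ⟨A, D, hA, hD, hPA⟩ := Chebyshev.exists_unitLower_diagonal (n + 1) P hP
  have h := Chebyshev.hasChebyshevPotential_fubiniStudy hP hA hD hPA hα.1 hα.2
  have hlog : ∀ (t : ℝ) (i : Fin (n + 1)), t * Real.log (t / Chebyshev.minorRatio P i) =
      t * Real.log t - t * Real.log (D i) := fun t i => by
    rw [Chebyshev.minorRatio_eq hA hD hPA]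
    -- on the boundary of the simplex both sides are `0`
    rcases eq_or_ne t 0 with rfl | ht
    · simp
    · rw [Real.log_div ht (hD i).ne', mul_sub]
  rw [Fin.sum_univ_castSucc] at h
  simp only [Fin.snoc_castSucc, Fin.snoc_last, ← hlog] at h
  simpa using h
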